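/- Let $\mathbb D$ be the open unit disc in $\mathbb C$, and let $\mathbb N=\{1,2,3,\dots\}$. A weight on $\mathbb D$ is a bounded, continuous, strictly positive function $\mu:\mathbb D\to(0,\infty)$. For a holomorphic $f:\mathbb D\to\mathbb C$ put $\|f\|_\mu:=\sup_{z\in\mathbb D}\mu(z)|f'(z)|\in[0,\infty]$. The $\mu$-Bloch space $\mathcal B^\mu$ consists of the holomorphic $f$ with $\|f\|_\mu<\infty$, and it carries the norm $|f(0)|+\|f\|_\mu$. For $k\in\{1,2\}$ and $\theta>1$, the $(k,\theta)$-log Bloch space $\mathcal B^{\log}_{k,\theta}$ is the space $\mathcal B^{v}$ for the weight $v(z)=(1-|z|^k)\log\frac{\theta}{1-|z|^k}$. Write $\|\cdot\|_{\log}$ for $\|\cdot\|_{v_{\log}}$ with $v_{\log}(z)=(1-|z|)\log\frac{3}{1-|z|}$, and let $F_j(z)=z^j$. For a holomorphic $\phi:\mathbb D\to\mathbb D$, let $C_\phi f=f\circ\phi$, and let $\phi^j$ denote the pointwise $j$-th power of $\phi$. That $C_\phi:\mathcal B^{\log}_{k,\theta}\to\mathcal B^\mu$ is bounded (compact) means that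 $C_\phi$ maps $\mathcal B^{\log}_{k,\theta}$ into $\mathcal B^\mu$ and is a bounded (compact) linear operator between these spaces. The essential norm $\|T\|_e$ of a bounded linear operator $T:X\to Y$ is the infimum of $\|T-S\|$ over all compact linear operators $S:X\to Y$. **Theorem.** Let $\theta\ge e$ and $k\in\{1,2\}$. For every holomorphic $\phi:\mathbb D\to\mathbb D$ and every weight $\mu$ on $\mathbb D$, the following hold. (A) $C_\phi:\mathcal B^{\log}_{k,\theta}\to\mathcal B^\mu$ is bounded if and only if $$\sup_{j\in\mathbb N}\frac{\|\phi^j\|_\mu}{\|F_j\|_{\log}}<\infty,$$ and also if and only if $$\sup_{j\in\mathbb N}\frac{\|\phi^j\|_\mu}{\log(j+1)}<\infty.$$ (B) $C_\phi:\mathcal B^{\log}_{k,\theta}\to\mathcal B^\mu$ is compact if and only if all the quotients $\|\phi^j\|_\mu/\|F_j\|_{\log}$, $j\in\mathbb N$, are finite and $$\lim_{j\to\infty}\frac{\|\phi^j\|_\mu}{\|F_j\|_{\log}}=0,$$ and also if and only if all the quotients $\|\phi^j\|_\mu/\log(j+1)$, $j\in\mathbb N$, are finite and $$\lim_{j\to\infty}\frac{\|\phi^j\|_\mu}{\log(j+1)}=0.$$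 (C) There is a constant $K>0$, depending only on $k$ and $\theta$, such that, for every holomorphic $\phi:\mathbb D\to\mathbb D$ and every weight $\mu$ on $\mathbb D$ for which $C_\phi$ maps $\mathcal B^{\log}_{k,\theta}$ into $\mathcal B^\mu$, the operator $C_\phi:\mathcal B^{\log}_{k,\theta}\to\mathcal B^\mu$ is continuous and, with $$E_1=\limsup_{j\to\infty}\frac{\|\phi^j\|_\mu}{\|F_j\|_{\log}},\qquad E_2=\limsup_{j\to\infty}\frac{\|\phi^j\|_\mu}{\log(j+1)},$$ one has $$\tfrac1K\|C_\phi\|_e\le E_1\le K\|C_\phi\|_e\qquad\text{and}\qquad \tfrac1K E_1\le E_2\le K E_1 .$$ -/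

import Mathlib

open Filter Topology
open scoped ENNReal NNReal Complex.UnitDisc

noncomputable section

namespace LogBloch

/-- A function on the unit disc, extended by `0` to the whole plane. It serves only to speak
about complex differentiability and the derivative at points of the (open) disc. -/
def extendZero (f : 𝔻 → ℂ) : ℂ → ℂ :=
  fun z => if hz : ‖z‖ < 1 then f (Complex.UnitDisc.mk z hz) else 0

/-- `f` is holomorphic on the unit disc. -/
def IsHolomorphic (f : 𝔻 → ℂ) : Prop :=
  DifferentiableOn ℂ (extendZero f) (Metric.ball 0 1)

/-- The complex derivative `f'(z)` at a point of the disc. -/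
def discDeriv (f : 𝔻 → ℂ) (z : 𝔻) : ℂ := deriv (extendZero f) (z : ℂ)

/-- A weight: a bounded, continuous, strictly positive function on the disc. -/
structure Weight where
  toFun : 𝔻 → ℝ
  continuous' : Continuous toFun
  bounded' : ∃ M : ℝ, ∀ z, toFun z ≤ M
  pos' : ∀ z, 0 < toFun z

instance : CoeFun Weight (fun _ => 𝔻 → ℝ) := ⟨Weight.toFun⟩

/-- The seminorm `‖f‖_μ = sup_z μ(z) |f'(z)|`, with values in `[0, ∞]`. -/
def blochSeminorm (μ : Weight) (f : 𝔻 → ℂ) : ℝ≥0∞ :=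
  ⨆ z : 𝔻, ENNReal.ofReal (μ z * ‖discDeriv f z‖)

theorem extendZero_coe (f : 𝔻 → ℂ) (z : 𝔻) : extendZero f (z : ℂ) = f z := by
  simp [extendZero, z.norm_lt_one]

theorem extendZero_zero : extendZero 0 = 0 := by
  funext z; simp [extendZero]

theorem extendZero_add (f g : 𝔻 → ℂ) : extendZero (f + g) = extendZero f + extendZero g := by
  funext z; by_cases hz : ‖z‖ < 1 <;> simp [extendZero, hz]

theorem extendZero_smul (c : ℂ) (f : 𝔻 → ℂ) : extendZero (c • f) = c • extendZero f := by
  funext z; by_cases hz : ‖z‖ < 1 <;> simp [extendZero, hz]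

theorem coe_mem_ball (z : 𝔻) : (z : ℂ) ∈ Metric.ball (0 : ℂ) 1 := by
  simpa using z.norm_lt_one

theorem IsHolomorphic.differentiableAt {f : 𝔻 → ℂ} (hf : IsHolomorphic f) (z : 𝔻) :
    DifferentiableAt ℂ (extendZero f) (z : ℂ) :=
  DifferentiableOn.differentiableAt hf (Metric.isOpen_ball.mem_nhds (coe_mem_ball z))

theorem discDeriv_add {f g : 𝔻 → ℂ} (hf : IsHolomorphic f) (hg : IsHolomorphic g) (z : 𝔻) :
    discDeriv (f + g) z = discDeriv f z + discDeriv g z := by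
  unfold discDeriv
  rw [extendZero_add]
  exact deriv_add (hf.differentiableAt z) (hg.differentiableAt z)

theorem discDeriv_smul (c : ℂ) {f : 𝔻 → ℂ} (hf : IsHolomorphic f) (z : 𝔻) :
    discDeriv (c • f) z = c * discDeriv f z := by
  unfold discDeriv
  rw [extendZero_smul]
  exact deriv_const_smul c (hf.differentiableAt z)

theorem blochSeminorm_zero (μ : Weight) : blochSeminorm μ 0 = 0 := by
  simp [blochSeminorm, discDeriv, extendZero_zero]

theorem blochSeminorm_add_le (μ : Weight) {f g : 𝔻 → ℂ} (hf : IsHolomorphic f)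
    (hg : IsHolomorphic g) :
    blochSeminorm μ (f + g) ≤ blochSeminorm μ f + blochSeminorm μ g := by
  refine iSup_le fun z => ?_
  have hμ := (μ.pos' z).le
  have h1 : μ z * ‖discDeriv (f + g) z‖ ≤ μ z * ‖discDeriv f z‖ + μ z * ‖discDeriv g z‖ := by
    rw [discDeriv_add hf hg, ← mul_add]
    exact mul_le_mul_of_nonneg_left (norm_add_le _ _) hμ
  refine (ENNReal.ofReal_le_ofReal h1).trans ?_
  rw [ENNReal.ofReal_add (by positivity) (by positivity)]
  exact add_le_add (le_iSup (fun z : 𝔻 => ENNReal.ofReal (μ z * ‖discDeriv f z‖)) z)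
    (le_iSup (fun z : 𝔻 => ENNReal.ofReal (μ z * ‖discDeriv g z‖)) z)

theorem blochSeminorm_smul (μ : Weight) (c : ℂ) {f : 𝔻 → ℂ} (hf : IsHolomorphic f) :
    blochSeminorm μ (c • f) = ENNReal.ofReal ‖c‖ * blochSeminorm μ f := by
  unfold blochSeminorm
  rw [ENNReal.mul_iSup]
  congr 1
  funext z
  rw [discDeriv_smul c hf, norm_mul, ← ENNReal.ofReal_mul (norm_nonneg c)]
  congr 1
  ring

/-- The `μ`-Bloch space as a linear subspace of the functions on the disc: the holomorphic `f`
with `‖f‖_μ < ∞`. -/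
def blochSubmodule (μ : Weight) : Submodule ℂ (𝔻 → ℂ) where
  carrier := {f | IsHolomorphic f ∧ blochSeminorm μ f < ∞}
  zero_mem' := by
    refine ⟨?_, ?_⟩
    · unfold IsHolomorphic
      rw [extendZero_zero]
      exact differentiableOn_const 0
    · rw [blochSeminorm_zero]
      exact ENNReal.zero_lt_top
  add_mem' := by
    rintro f g ⟨hf, hf'⟩ ⟨hg, hg'⟩
    refine ⟨?_, (blochSeminorm_add_le μ hf hg).trans_lt (ENNReal.add_lt_top.2 ⟨hf', hg'⟩)⟩
    unfold IsHolomorphic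
    rw [extendZero_add]
    exact DifferentiableOn.add hf hg
  smul_mem' := by
    rintro c f ⟨hf, hf'⟩
    refine ⟨?_, ?_⟩
    · unfold IsHolomorphic
      rw [extendZero_smul]
      exact DifferentiableOn.const_smul hf c
    · rw [blochSeminorm_smul μ c hf]
      exact ENNReal.mul_lt_top ENNReal.ofReal_lt_top hf'

/-- The `μ`-Bloch space. It is a separate type, so that its topology is the one given by the
norm below, and not the topology of pointwise convergence. -/
def BlochSpace (μ : Weight) : Type := ↥(blochSubmodule μ)

instance (μ : Weight) : AddCommGroup (BlochSpace μ) :=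
  inferInstanceAs (AddCommGroup ↥(blochSubmodule μ))

instance (μ : Weight) : Module ℂ (BlochSpace μ) :=
  inferInstanceAs (Module ℂ ↥(blochSubmodule μ))

/-- The inclusion of the `μ`-Bloch space in the functions on the disc. -/
def BlochSpace.incl (μ : Weight) : BlochSpace μ →ₗ[ℂ] (𝔻 → ℂ) := (blochSubmodule μ).subtype

/-- The norm `|f(0)| + ‖f‖_μ`. -/
instance (μ : Weight) : Norm (BlochSpace μ) :=
  ⟨fun f => ‖BlochSpace.incl μ f 0‖ + (blochSeminorm μ (BlochSpace.incl μ f)).toReal⟩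

theorem BlochSpace.norm_def {μ : Weight} (f : BlochSpace μ) :
    ‖f‖ = ‖BlochSpace.incl μ f 0‖ + (blochSeminorm μ (BlochSpace.incl μ f)).toReal := rfl

theorem BlochSpace.holo {μ : Weight} (f : BlochSpace μ) : IsHolomorphic (BlochSpace.incl μ f) :=
  f.2.1

theorem BlochSpace.finite {μ : Weight} (f : BlochSpace μ) :
    blochSeminorm μ (BlochSpace.incl μ f) ≠ ∞ :=
  f.2.2.ne

theorem eq_zero_of_blochSeminorm {μ : Weight} {f : 𝔻 → ℂ} (hf : IsHolomorphic f) (h0 : f 0 = 0)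
    (h : blochSeminorm μ f = 0) : f = 0 := by
  have hd : ∀ z : 𝔻, discDeriv f z = 0 := by
    intro z
    have h1 : ENNReal.ofReal (μ z * ‖discDeriv f z‖) ≤ 0 :=
      h ▸ le_iSup (fun z : 𝔻 => ENNReal.ofReal (μ z * ‖discDeriv f z‖)) z
    have h2 : μ z * ‖discDeriv f z‖ ≤ 0 := ENNReal.ofReal_eq_zero.1 (le_antisymm h1 bot_le)
    have h3 := μ.pos' z
    have h4 : ‖discDeriv f z‖ ≤ 0 := by
      by_contra hc
      push Not at hc
      exact absurd h2 (not_le.2 (mul_pos h3 hc))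
    simpa using h4
  funext z
  have hconst : extendZero f (z : ℂ) = extendZero f ((0 : 𝔻) : ℂ) := by
    refine (convex_ball (0 : ℂ) 1).is_const_of_fderivWithin_eq_zero (𝕜 := ℂ) hf ?_
      (coe_mem_ball z) (coe_mem_ball 0)
    intro x hx
    have hx1 : ‖x‖ < 1 := by simpa using hx
    have hdx : deriv (extendZero f) x = 0 := hd (Complex.UnitDisc.mk x hx1)
    rw [fderivWithin_of_isOpen Metric.isOpen_ball hx]
    ext
    simp [hdx]
  rw [extendZero_coe, extendZero_coe, h0] at hconst
  simpa using hconst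

theorem BlochSpace.core (μ : Weight) : NormedSpace.Core ℂ (BlochSpace μ) where
  norm_nonneg f := by rw [BlochSpace.norm_def]; positivity
  norm_smul c f := by
    simp only [BlochSpace.norm_def, map_smul]
    rw [blochSeminorm_smul μ c f.holo, ENNReal.toReal_mul, ENNReal.toReal_ofReal (norm_nonneg c)]
    simp only [Pi.smul_apply, norm_smul]
    ring
  norm_triangle f g := by
    simp only [BlochSpace.norm_def, map_add]
    have h1 := ENNReal.toReal_mono (ENNReal.add_ne_top.2 ⟨f.finite, g.finite⟩)
      (blochSeminorm_add_le μ f.holo g.holo)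
    rw [ENNReal.toReal_add f.finite g.finite] at h1
    have h2 := norm_add_le (BlochSpace.incl μ f 0) (BlochSpace.incl μ g 0)
    simp only [Pi.add_apply]
    linarith
  norm_eq_zero_iff f := by
    constructor
    · intro h
      rw [BlochSpace.norm_def] at h
      have h1 := (add_eq_zero_iff_of_nonneg (norm_nonneg _) ENNReal.toReal_nonneg).1 h
      have h2 : blochSeminorm μ (BlochSpace.incl μ f) = 0 :=
        ((ENNReal.toReal_eq_zero_iff _).1 h1.2).resolve_right f.finite
      exact Subtype.ext (eq_zero_of_blochSeminorm f.holo (norm_eq_zero.1 h1.1) h2)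
    · rintro rfl
      simp [BlochSpace.norm_def, blochSeminorm_zero]

instance (μ : Weight) : NormedAddCommGroup (BlochSpace μ) :=
  NormedAddCommGroup.ofCore (BlochSpace.core μ)

instance (μ : Weight) : NormedSpace ℂ (BlochSpace μ) :=
  NormedSpace.ofCore (BlochSpace.core μ)

theorem one_sub_pow_mem {k : ℕ} (hk : k = 1 ∨ k = 2) (z : 𝔻) :
    0 < 1 - ‖(z : ℂ)‖ ^ k ∧ 1 - ‖(z : ℂ)‖ ^ k ≤ 1 := by
  have h0 := norm_nonneg (z : ℂ)
  have h2 : ‖(z : ℂ)‖ ^ k < 1 := pow_lt_one₀ h0 z.norm_lt_one (by omega)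
  have h3 : 0 ≤ ‖(z : ℂ)‖ ^ k := by positivity
  constructor <;> linarith

/-- The weight `v_θ^{(k)}(z) = (1 - |z|^k) log (θ / (1 - |z|^k))`, for `k ∈ {1, 2}`, `θ > 1`. -/
def logWeight (k : ℕ) (θ : ℝ) (hk : k = 1 ∨ k = 2) (hθ : 1 < θ) : Weight where
  toFun z := (1 - ‖(z : ℂ)‖ ^ k) * Real.log (θ / (1 - ‖(z : ℂ)‖ ^ k))
  continuous' := by
    have hc : Continuous fun z : 𝔻 => 1 - ‖(z : ℂ)‖ ^ k := by fun_prop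
    have hne : ∀ z : 𝔻, 1 - ‖(z : ℂ)‖ ^ k ≠ 0 := fun z => (one_sub_pow_mem hk z).1.ne'
    exact hc.mul ((continuous_const.div hc hne).log
      fun z => div_ne_zero (by linarith) (hne z))
  bounded' := by
    refine ⟨θ, fun z => ?_⟩
    have h1 := (one_sub_pow_mem hk z).1
    have h2 : Real.log (θ / (1 - ‖(z : ℂ)‖ ^ k)) ≤ θ / (1 - ‖(z : ℂ)‖ ^ k) :=
      Real.log_le_self (div_nonneg (by linarith) h1.le)
    calc _ ≤ (1 - ‖(z : ℂ)‖ ^ k) * (θ / (1 - ‖(z : ℂ)‖ ^ k)) :=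
          mul_le_mul_of_nonneg_left h2 h1.le
      _ = θ := mul_div_cancel₀ θ h1.ne'
  pos' z := by
    have h1 := one_sub_pow_mem hk z
    refine mul_pos h1.1 (Real.log_pos ?_)
    rw [one_lt_div h1.1]
    linarith [h1.2]

/-- The weight `v_log(z) = (1 - |z|) log (3 / (1 - |z|))` of the log-Bloch space. -/
def vlog : Weight := logWeight 1 3 (Or.inl rfl) (by norm_num)

theorem one_lt_of_exp_le {θ : ℝ} (hθ : Real.exp 1 ≤ θ) : 1 < θ :=
  (Real.one_lt_exp_iff.2 one_pos).trans_le hθ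

/-- The monomial `F_j(z) = z^j` on the disc. -/
def monomial (j : ℕ) : 𝔻 → ℂ := fun z => (z : ℂ) ^ j

/-- The power `φ^j` (pointwise product) of a self-map of the disc. -/
def selfMapPow (φ : 𝔻 → 𝔻) (j : ℕ) : 𝔻 → ℂ := fun z => (φ z : ℂ) ^ j

/-- `C_φ` maps the `ν`-Bloch space into the `μ`-Bloch space. -/
def MapsBloch (φ : 𝔻 → 𝔻) (ν μ : Weight) : Prop :=
  ∀ f ∈ blochSubmodule ν, f ∘ φ ∈ blochSubmodule μ

/-- The composition operator `C_φ f = f ∘ φ` as a linear map between Bloch spaces. -/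
def compOp {φ : 𝔻 → 𝔻} {ν μ : Weight} (h : MapsBloch φ ν μ) :
    BlochSpace ν →ₗ[ℂ] BlochSpace μ where
  toFun f := ⟨BlochSpace.incl ν f ∘ φ, h _ f.2⟩
  map_add' _ _ := rfl
  map_smul' _ _ := rfl

/-- `C_φ` is a bounded operator from the `ν`-Bloch space to the `μ`-Bloch space. -/
def IsBoundedComp (φ : 𝔻 → 𝔻) (ν μ : Weight) : Prop :=
  ∃ h : MapsBloch φ ν μ, ∃ M : ℝ, ∀ f : BlochSpace ν, ‖compOp h f‖ ≤ M * ‖f‖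

/-- `C_φ` is a compact operator from the `ν`-Bloch space to the `μ`-Bloch space. -/
def IsCompactComp (φ : 𝔻 → 𝔻) (ν μ : Weight) : Prop :=
  ∃ h : MapsBloch φ ν μ, IsCompactOperator (compOp h)

/-- The essential norm of a continuous linear operator: the infimum of `‖T - S‖` over the compact
operators `S`. -/
def essNorm {X Y : Type*} [NormedAddCommGroup X] [NormedSpace ℂ X] [NormedAddCommGroup Y]
    [NormedSpace ℂ Y] (T : X →L[ℂ] Y) : ℝ :=
  sInf {r : ℝ | ∃ S : X →L[ℂ] Y, IsCompactOperator S ∧ r = ‖T - S‖}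

/-- The two quantities agree up to the factor `K`: `A / K ≤ B ≤ K A`. -/
def EquivUpTo (K : ℝ≥0) (A B : ℝ≥0∞) : Prop := A ≤ K * B ∧ B ≤ K * A

/-- The quotient `‖φ^j‖_μ / ‖F_j‖_log`. -/
def normRatio (φ : 𝔻 → 𝔻) (μ : Weight) (j : ℕ) : ℝ≥0∞ :=
  blochSeminorm μ (selfMapPow φ j) / blochSeminorm vlog (monomial j)

/-- The quotient `‖φ^j‖_μ / log (j + 1)`. -/
def logRatio (φ : 𝔻 → 𝔻) (μ : Weight) (j : ℕ) : ℝ≥0∞ :=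
  blochSeminorm μ (selfMapPow φ j) / ENNReal.ofReal (Real.log ((j : ℝ) + 1))

/-- The supremum of the sequence over the indices `j = 1, 2, 3, …`. -/
def supPos (a : ℕ → ℝ≥0∞) : ℝ≥0∞ := ⨆ (j : ℕ) (_ : 1 ≤ j), a j

end LogBloch

end

open Filter Topology
open scoped ENNReal NNReal Complex.UnitDisc

noncomputable section

namespace LogBloch

/-! ### Derivatives of functions on the disc -/

/-! By the chain rule, `C_φ` is bounded as soon as `μ |φ'| ≤ C ν(φ)` on the disc, `ν` being the
logarithmic weight. Monomials test this inequality at every point: the supremum of `v_log(z) j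
|z|^(j-1)` is comparable to `log (j + 1)`, and at radius `r` the degree `⌊1 / (1 - r)⌋` attains a
fixed fraction of it (`exists_log_le_mul_vlog`). As `ν` is comparable to `v_log`, finiteness of the
supremum of `logRatio` is equivalent to boundedness. The two quotients differ by at most a factor 3,
so everything is proved for `logRatio`.

Upper bound for the essential norm: `C_φ` is approximated by finite rank operators that compose
Taylor polynomials of dilations of `f` with `φ`. Where `|φ|` stays away from 1 the approximation is
as good as desired; where `|φ|` is near 1 the error is only bounded by a multiple of `‖f‖`, but
there the quotients of large index control `μ |φ'| / ν(φ)`.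

Lower bound: a compact operator sends the normalized monomials to a null sequence. This is shown by
a gliding hump. If infinitely many images were close to some `h ≠ 0`, one could add `N` such
monomials of rapidly growing degree. Their weighted derivatives peak in almost disjoint annuli, so
the sum has norm at most `3A + Nε`, while its image is within `Nε` of `N h`: impossible for small
`ε` and large `N`.

Compactness follows from the same two estimates, since the compact operators form a closed set. -/

theorem extendZero_eventuallyEq {f : 𝔻 → ℂ} {g : ℂ → ℂ} (h : ∀ z : 𝔻, f z = g z) (z : 𝔻) :
    extendZero f =ᶠ[𝓝 (z : ℂ)] g := by
  filter_upwards [Metric.isOpen_ball.mem_nhds (coe_mem_ball z)] with w hw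
  have hw' : ‖w‖ < 1 := by simpa using hw
  simp [extendZero, hw', h]

theorem isHolomorphic_of_eq {f : 𝔻 → ℂ} {g : ℂ → ℂ} (h : ∀ z : 𝔻, f z = g z)
    (hg : DifferentiableOn ℂ g (Metric.ball 0 1)) : IsHolomorphic f := by
  refine DifferentiableOn.congr hg fun w hw => ?_
  have hw' : ‖w‖ < 1 := by simpa using hw
  simp [extendZero, hw', h]

theorem discDeriv_of_eq {f : 𝔻 → ℂ} {g : ℂ → ℂ} (h : ∀ z : 𝔻, f z = g z) (z : 𝔻) :
    discDeriv f z = deriv g z :=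
  (extendZero_eventuallyEq h z).deriv_eq

theorem discDeriv_sub {f g : 𝔻 → ℂ} (hf : IsHolomorphic f) (hg : IsHolomorphic g) (z : 𝔻) :
    discDeriv (f - g) z = discDeriv f z - discDeriv g z := by
  have h : extendZero (f - g) = extendZero f - extendZero g := by
    funext w; by_cases hw : ‖w‖ < 1 <;> simp [extendZero, hw]
  unfold discDeriv
  rw [h]
  exact deriv_sub (hf.differentiableAt z) (hg.differentiableAt z)

theorem extendZero_comp_selfMap (f : 𝔻 → ℂ) (φ : 𝔻 → 𝔻) (z : 𝔻) :
    (f ∘ φ) z = (extendZero f ∘ extendZero fun z => (φ z : ℂ)) z := by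
  simp [extendZero_coe]

theorem IsHolomorphic.comp_selfMap {f : 𝔻 → ℂ} {φ : 𝔻 → 𝔻} (hf : IsHolomorphic f)
    (hφ : IsHolomorphic fun z => (φ z : ℂ)) : IsHolomorphic (f ∘ φ) := by
  refine isHolomorphic_of_eq (extendZero_comp_selfMap f φ) (DifferentiableOn.comp hf hφ ?_)
  intro w hw
  have hw' : ‖w‖ < 1 := by simpa using hw
  simpa [extendZero, hw'] using (φ (Complex.UnitDisc.mk w hw')).norm_lt_one

theorem discDeriv_comp_selfMap {f : 𝔻 → ℂ} {φ : 𝔻 → 𝔻} (hf : IsHolomorphic f)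
    (hφ : IsHolomorphic fun z => (φ z : ℂ)) (z : 𝔻) :
    discDeriv (f ∘ φ) z = discDeriv f (φ z) * discDeriv (fun z => (φ z : ℂ)) z := by
  have h2 := extendZero_coe (fun z => (φ z : ℂ)) z
  rw [discDeriv_of_eq (extendZero_comp_selfMap f φ), deriv_comp _ _ (hφ.differentiableAt z), h2]
  · rfl
  · rw [h2]
    exact hf.differentiableAt _

theorem monomial_isHolomorphic (j : ℕ) : IsHolomorphic (monomial j) :=
  isHolomorphic_of_eq (g := fun w => w ^ j) (fun _ => rfl) (by fun_prop)

theorem discDeriv_monomial (j : ℕ) (z : 𝔻) :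
    discDeriv (monomial j) z = j * (z : ℂ) ^ (j - 1) := by
  rw [discDeriv_of_eq (f := monomial j) (g := fun w => w ^ j) (fun _ => rfl)]
  simp

theorem selfMapPow_eq (φ : 𝔻 → 𝔻) (j : ℕ) : selfMapPow φ j = monomial j ∘ φ := rfl

theorem norm_discDeriv_selfMapPow {φ : 𝔻 → 𝔻} (hφ : IsHolomorphic fun z => (φ z : ℂ)) (j : ℕ)
    (z : 𝔻) : ‖discDeriv (selfMapPow φ j) z‖ =
      j * ‖(φ z : ℂ)‖ ^ (j - 1) * ‖discDeriv (fun z => (φ z : ℂ)) z‖ := by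
  rw [selfMapPow_eq, discDeriv_comp_selfMap (monomial_isHolomorphic j) hφ, discDeriv_monomial]
  simp

/-! ### The Bloch norm -/

theorem blochSeminorm_le_ofReal_iff {μ : Weight} {f : 𝔻 → ℂ} {C : ℝ} (hC : 0 ≤ C) :
    blochSeminorm μ f ≤ ENNReal.ofReal C ↔ ∀ z, μ z * ‖discDeriv f z‖ ≤ C := by
  simp only [blochSeminorm, iSup_le_iff, ENNReal.ofReal_le_ofReal_iff hC]

theorem blochSeminorm_lt_top_of_le {μ : Weight} {f : 𝔻 → ℂ} {C : ℝ}
    (h : ∀ z, μ z * ‖discDeriv f z‖ ≤ C) : blochSeminorm μ f < ∞ := by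
  have hC : 0 ≤ C := (mul_nonneg (μ.pos' 0).le (norm_nonneg _)).trans (h 0)
  exact ((blochSeminorm_le_ofReal_iff hC).2 h).trans_lt ENNReal.ofReal_lt_top

/-- An element of the Bloch space, from a function with the defining property. -/
def BlochSpace.ofMem {μ : Weight} {f : 𝔻 → ℂ} (h : f ∈ blochSubmodule μ) : BlochSpace μ := ⟨f, h⟩

@[simp] theorem BlochSpace.incl_ofMem {μ : Weight} {f : 𝔻 → ℂ} (h : f ∈ blochSubmodule μ) :
    BlochSpace.incl μ (BlochSpace.ofMem h) = f := rfl

theorem BlochSpace.incl_injective (μ : Weight) : Function.Injective (BlochSpace.incl μ) :=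
  Subtype.val_injective

theorem BlochSpace.norm_apply_zero_le {μ : Weight} (f : BlochSpace μ) :
    ‖BlochSpace.incl μ f 0‖ ≤ ‖f‖ := by
  rw [BlochSpace.norm_def]
  linarith [ENNReal.toReal_nonneg (a := blochSeminorm μ (BlochSpace.incl μ f))]

theorem BlochSpace.blochSeminorm_le_norm {μ : Weight} (f : BlochSpace μ) :
    blochSeminorm μ (BlochSpace.incl μ f) ≤ ENNReal.ofReal ‖f‖ := by
  rw [← ENNReal.ofReal_toReal f.finite, BlochSpace.norm_def]
  exact ENNReal.ofReal_le_ofReal (by linarith [norm_nonneg (BlochSpace.incl μ f 0)])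

theorem BlochSpace.mul_norm_discDeriv_le {μ : Weight} (f : BlochSpace μ) (z : 𝔻) :
    μ z * ‖discDeriv (BlochSpace.incl μ f) z‖ ≤ ‖f‖ :=
  (blochSeminorm_le_ofReal_iff (norm_nonneg f)).1 f.blochSeminorm_le_norm z

theorem BlochSpace.norm_le_add {μ : Weight} (f : BlochSpace μ) {a b : ℝ}
    (ha : ‖BlochSpace.incl μ f 0‖ ≤ a) (hb : ∀ z, μ z * ‖discDeriv (BlochSpace.incl μ f) z‖ ≤ b) :
    ‖f‖ ≤ a + b := by
  have hC : 0 ≤ b := (mul_nonneg (μ.pos' 0).le (norm_nonneg _)).trans (hb 0)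
  rw [BlochSpace.norm_def]
  exact add_le_add ha (ENNReal.toReal_le_of_le_ofReal hC ((blochSeminorm_le_ofReal_iff hC).2 hb))

theorem Weight.exists_lower_bound (μ : Weight) {ρ : ℝ} (hρ : ρ < 1) :
    ∃ m > 0, ∀ z : 𝔻, ‖(z : ℂ)‖ ≤ ρ → m ≤ μ z := by
  have hK : IsCompact ((↑) ⁻¹' Metric.closedBall (0 : ℂ) ρ : Set 𝔻) := by
    refine (Complex.UnitDisc.isEmbedding_coe.isInducing.isCompact_preimage_iff ?_).2
      (isCompact_closedBall 0 ρ)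
    intro w hw
    have hw' : ‖w‖ ≤ ρ := by simpa using hw
    exact ⟨Complex.UnitDisc.mk w (hw'.trans_lt hρ), rfl⟩
  -- The disc of radius `ρ` is empty when `ρ < 0`; any positive constant then serves.
  rcases Set.eq_empty_or_nonempty ((↑) ⁻¹' Metric.closedBall (0 : ℂ) ρ : Set 𝔻) with he | hne
  · refine ⟨1, one_pos, fun z hz => absurd (show z ∈ (∅ : Set 𝔻) from he ▸ ?_) (by simp)⟩
    simpa using hz
  · obtain ⟨z₀, -, hz₀⟩ := hK.exists_isMinOn hne μ.continuous'.continuousOn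
    exact ⟨μ z₀, μ.pos' z₀, fun z hz => hz₀ (by simpa using hz)⟩

theorem norm_apply_sub_le {f : 𝔻 → ℂ} (hf : IsHolomorphic f) {ρ D : ℝ}
    (hρ : ρ < 1) (h : ∀ z : 𝔻, ‖(z : ℂ)‖ ≤ ρ → ‖discDeriv f z‖ ≤ D) (z : 𝔻)
    (hz : ‖(z : ℂ)‖ ≤ ρ) : ‖f z - f 0‖ ≤ D * ‖(z : ℂ)‖ := by
  have h0 : 0 ≤ ρ := (norm_nonneg _).trans hz
  have hmem : ∀ w ∈ Metric.closedBall (0 : ℂ) ρ, ‖w‖ < 1 := fun w hw =>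
    (by simpa using hw : ‖w‖ ≤ ρ).trans_lt hρ
  have := (convex_closedBall (0 : ℂ) ρ).norm_image_sub_le_of_norm_deriv_le (𝕜 := ℂ)
    (f := extendZero f) (C := D) (x := ((0 : 𝔻) : ℂ)) (y := z)
    (fun w hw => hf.differentiableAt (Complex.UnitDisc.mk w (hmem w hw)))
    (fun w hw => h (Complex.UnitDisc.mk w (hmem w hw)) (by simpa using hw))
    (by simpa using h0) (by simpa using hz)
  rw [extendZero_coe, extendZero_coe] at this
  simpa using this

/-- On a smaller disc the weight is bounded below, so the norm controls `f'` there, and the mean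
value inequality from `0` controls `f`. -/
theorem BlochSpace.exists_norm_apply_le (μ : Weight) {ρ : ℝ} (hρ : ρ < 1) :
    ∃ C, 0 ≤ C ∧ ∀ (f : BlochSpace μ) (z : 𝔻), ‖(z : ℂ)‖ ≤ ρ →
      ‖BlochSpace.incl μ f z‖ ≤ C * ‖f‖ := by
  obtain ⟨m, hm, hmz⟩ := μ.exists_lower_bound hρ
  refine ⟨1 / m + 1, by positivity, fun f z hz => ?_⟩
  have h1 := norm_apply_sub_le (D := ‖f‖ / m) f.holo hρ (fun w hw => by
    rw [le_div_iff₀ hm, mul_comm]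
    exact (mul_le_mul_of_nonneg_right (hmz w hw) (norm_nonneg _)).trans
      (f.mul_norm_discDeriv_le w)) z hz
  have h2 := f.norm_apply_zero_le
  have h3 : ‖f‖ / m * ‖(z : ℂ)‖ ≤ ‖f‖ / m :=
    mul_le_of_le_one_right (by positivity) z.norm_lt_one.le
  have h4 := norm_sub_norm_le (BlochSpace.incl μ f z) (BlochSpace.incl μ f 0)
  have h5 : (1 / m + 1) * ‖f‖ = ‖f‖ / m + ‖f‖ := by ring
  linarith

/-- Evaluation at a point of the disc. -/
def BlochSpace.eval (μ : Weight) (z : 𝔻) : BlochSpace μ →L[ℂ] ℂ :=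
  ((LinearMap.proj z).comp (BlochSpace.incl μ)).mkContinuousOfExistsBound (by
    obtain ⟨C, -, hC⟩ := BlochSpace.exists_norm_apply_le μ z.norm_lt_one
    exact ⟨C, fun f => hC f z le_rfl⟩)

@[simp] theorem BlochSpace.eval_apply (μ : Weight) (z : 𝔻) (f : BlochSpace μ) :
    BlochSpace.eval μ z f = BlochSpace.incl μ f z := rfl

/-- Completeness is what the closed graph theorem requires. A Cauchy sequence converges locally
uniformly, so by Weierstrass the limit is holomorphic and the derivatives converge. -/
instance (μ : Weight) : CompleteSpace (BlochSpace μ) := by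
  refine Metric.complete_of_cauchySeq_tendsto fun u hu => ?_
  have hpt : ∀ z : 𝔻, ∃ c, Tendsto (fun n => BlochSpace.incl μ (u n) z) atTop (𝓝 c) := fun z =>
    cauchySeq_tendsto_of_complete
      (hu.map (BlochSpace.eval μ z).uniformContinuous)
  choose F hF using hpt
  have hbound : ∀ ε > 0, ∃ N, ∀ n ≥ N, ∀ m ≥ N, ‖u n - u m‖ ≤ ε := by
    intro ε hε
    obtain ⟨N, hN⟩ := Metric.cauchySeq_iff.1 hu ε hε
    exact ⟨N, fun n hn m hm => by simpa [dist_eq_norm] using (hN n hn m hm).le⟩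
  have hlu : TendstoLocallyUniformlyOn (fun n => extendZero (BlochSpace.incl μ (u n)))
      (extendZero F) atTop (Metric.ball 0 1) := by
    rw [tendstoLocallyUniformlyOn_iff_forall_isCompact Metric.isOpen_ball]
    intro K hK hKc
    obtain ⟨ρ, hρ, hKρ⟩ := exists_lt_subset_ball hKc.isClosed hK
    obtain ⟨C, hC0, hC⟩ := BlochSpace.exists_norm_apply_le μ hρ
    rw [Metric.tendstoUniformlyOn_iff]
    intro ε hε
    obtain ⟨N, hN⟩ := hbound (ε / (2 * (C + 1))) (by positivity)
    filter_upwards [eventually_ge_atTop N] with n hn w hw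
    have hwρ : ‖w‖ < ρ := by simpa using hKρ hw
    have hw1 : ‖w‖ < 1 := hwρ.trans hρ
    set z := Complex.UnitDisc.mk w hw1
    have h1 : ‖F z - BlochSpace.incl μ (u n) z‖ ≤ ε / 2 := by
      refine le_of_tendsto ((hF z).sub_const _).norm ?_
      filter_upwards [eventually_ge_atTop N] with m hm
      have h2 := hC (u m - u n) z hwρ.le
      have h3 := hN m hm n hn
      rw [map_sub, Pi.sub_apply] at h2
      calc _ ≤ C * (ε / (2 * (C + 1))) := h2.trans (by gcongr)
        _ ≤ (C + 1) * (ε / (2 * (C + 1))) := by gcongr; linarith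
        _ = ε / 2 := by field_simp
    rw [dist_eq_norm]
    have h4 : extendZero F w = F z := extendZero_coe F z
    have h5 : extendZero (BlochSpace.incl μ (u n)) w = BlochSpace.incl μ (u n) z :=
      extendZero_coe _ z
    rw [h4, h5]
    linarith
  have hev : ∀ᶠ n in atTop,
      DifferentiableOn ℂ (extendZero (BlochSpace.incl μ (u n))) (Metric.ball 0 1) :=
    Eventually.of_forall fun n => (u n).holo
  have hFh : IsHolomorphic F := hlu.differentiableOn hev Metric.isOpen_ball
  have hd : ∀ z : 𝔻, Tendsto (fun n => discDeriv (BlochSpace.incl μ (u n)) z) atTop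
      (𝓝 (discDeriv F z)) := fun z =>
    (hlu.deriv hev Metric.isOpen_ball).tendsto_at (coe_mem_ball z)
  -- Let `m → ∞` in the Cauchy estimate at a fixed `z`; the index `N` does not depend on `z`.
  have hlim : ∀ ε > 0, ∃ N, ∀ n ≥ N, ∀ z,
      μ z * ‖discDeriv (BlochSpace.incl μ (u n)) z - discDeriv F z‖ ≤ ε := by
    intro ε hε
    obtain ⟨N, hN⟩ := hbound ε hε
    refine ⟨N, fun n hn z => ?_⟩
    refine le_of_tendsto (((hd z).const_sub _).norm.const_mul _) ?_
    filter_upwards [eventually_ge_atTop N] with m hm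
    have := (u n - u m).mul_norm_discDeriv_le z
    rw [map_sub, discDeriv_sub (u n).holo (u m).holo] at this
    exact this.trans (hN n hn m hm)
  have hmem : F ∈ blochSubmodule μ := by
    refine ⟨hFh, ?_⟩
    obtain ⟨N, hN⟩ := hlim 1 one_pos
    refine blochSeminorm_lt_top_of_le (C := ‖u N‖ + 1) fun z => ?_
    have h1 := hN N le_rfl z
    have h2 := (u N).mul_norm_discDeriv_le z
    have h3 := norm_sub_norm_le (discDeriv F z) (discDeriv (BlochSpace.incl μ (u N)) z)
    rw [norm_sub_rev] at h3
    have h4 := mul_le_mul_of_nonneg_left h3 (μ.pos' z).le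
    rw [mul_sub] at h4
    linarith
  refine ⟨BlochSpace.ofMem hmem, tendsto_iff_norm_sub_tendsto_zero.2 ?_⟩
  rw [Metric.tendsto_atTop]
  intro ε hε
  obtain ⟨N, hN⟩ := hlim (ε / 3) (by positivity)
  have h0 := Metric.tendsto_atTop.1 (hF 0) (ε / 3) (by positivity)
  obtain ⟨N', hN'⟩ := h0
  refine ⟨max N N', fun n hn => ?_⟩
  have h1 := (u n - BlochSpace.ofMem hmem).norm_le_add (a := ε / 3) (b := ε / 3) (by
    have := hN' n ((le_max_right _ _).trans hn)
    rw [dist_eq_norm] at this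
    simpa using this.le) (fun z => by
    rw [map_sub, BlochSpace.incl_ofMem, discDeriv_sub (u n).holo hFh]
    exact hN n ((le_max_left _ _).trans hn) z)
  rw [Real.dist_eq, sub_zero, abs_of_nonneg (norm_nonneg _)]
  linarith

/-! ### Composition operators -/

@[simp] theorem incl_compOp {φ : 𝔻 → 𝔻} {ν μ : Weight} (h : MapsBloch φ ν μ) (f : BlochSpace ν) :
    BlochSpace.incl μ (compOp h f) = BlochSpace.incl ν f ∘ φ := rfl

/-- A composition operator between Bloch spaces is continuous, by the closed graph theorem. -/
theorem continuous_compOp {φ : 𝔻 → 𝔻} {ν μ : Weight} (h : MapsBloch φ ν μ) :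
    Continuous (compOp h) := by
  refine (compOp h).continuous_of_seq_closed_graph fun u f g hu hg => ?_
  refine BlochSpace.incl_injective μ (funext fun z => ?_)
  have h1 := ((BlochSpace.eval μ z).continuous.tendsto g).comp hg
  -- Evaluating `C_φ (u n)` at `z` is evaluating `u n` at `φ z`, so both limits belong to one
  -- sequence.
  have h2 := ((BlochSpace.eval ν (φ z)).continuous.tendsto f).comp hu
  exact tendsto_nhds_unique h1 h2

theorem isBoundedComp_iff_mapsBloch {φ : 𝔻 → 𝔻} {ν μ : Weight} :
    IsBoundedComp φ ν μ ↔ MapsBloch φ ν μ := by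
  refine ⟨fun ⟨h, _⟩ => h, fun h => ⟨h, ‖(⟨compOp h, continuous_compOp h⟩ :
    BlochSpace ν →L[ℂ] BlochSpace μ)‖, fun f => ?_⟩⟩
  exact ContinuousLinearMap.le_opNorm (⟨compOp h, continuous_compOp h⟩ :
    BlochSpace ν →L[ℂ] BlochSpace μ) f

/-! ### The logarithmic weights -/

theorem logWeight_apply (k : ℕ) (θ : ℝ) (hk : k = 1 ∨ k = 2) (hθ : 1 < θ) (z : 𝔻) :
    logWeight k θ hk hθ z = (1 - ‖(z : ℂ)‖ ^ k) * Real.log (θ / (1 - ‖(z : ℂ)‖ ^ k)) := rfl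

theorem vlog_apply (z : 𝔻) :
    vlog z = (1 - ‖(z : ℂ)‖) * Real.log (3 / (1 - ‖(z : ℂ)‖)) := by
  have : vlog z = (1 - ‖(z : ℂ)‖ ^ 1) * Real.log (3 / (1 - ‖(z : ℂ)‖ ^ 1)) := rfl
  simpa using this

/-- The derivative of `t log (θ / t)` is `log (θ / t) - 1`, nonnegative on `(0, 1]` because `θ ≥ e`.
The proof replaces calculus by `log x ≤ x - 1` at `x = t / s`. -/
theorem mul_log_div_mono {θ : ℝ} (hθ : Real.exp 1 ≤ θ) {s t : ℝ} (hs : 0 < s) (hst : s ≤ t)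
    (ht : t ≤ 1) : s * Real.log (θ / s) ≤ t * Real.log (θ / t) := by
  have ht0 : 0 < t := hs.trans_le hst
  have hθ0 : 0 < θ := (Real.exp_pos 1).trans_le hθ
  have h1 : 1 ≤ Real.log (θ / t) := by
    rw [Real.le_log_iff_exp_le (by positivity), le_div_iff₀ ht0]
    nlinarith [Real.exp_pos 1]
  have h2 : Real.log (θ / s) = Real.log (θ / t) + Real.log (t / s) := by
    rw [← Real.log_mul (by positivity) (by positivity)]
    congr 1
    field_simp
  have h3 : Real.log (t / s) ≤ t / s - 1 := Real.log_le_sub_one_of_pos (by positivity)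
  have h4 : s * (t / s - 1) = t - s := by field_simp
  have h5 := mul_le_mul_of_nonneg_left h3 hs.le
  rw [h2]
  nlinarith

theorem exp_one_le_three : Real.exp 1 ≤ 3 := by linarith [Real.exp_one_lt_d9]

theorem one_sub_le_one_sub_pow {k : ℕ} (hk : k = 1 ∨ k = 2) {r : ℝ} (h0 : 0 ≤ r) (h1 : r ≤ 1) :
    1 - r ≤ 1 - r ^ k ∧ 1 - r ^ k ≤ 2 * (1 - r) := by
  rcases hk with rfl | rfl
  · constructor <;> linarith [pow_one r]
  · constructor <;> nlinarith

section

variable {k : ℕ} {θ : ℝ} (hk : k = 1 ∨ k = 2) (hθ : Real.exp 1 ≤ θ)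

theorem logWeight_antitone {z w : 𝔻} (h : ‖(w : ℂ)‖ ≤ ‖(z : ℂ)‖) :
    logWeight k θ hk (one_lt_of_exp_le hθ) z ≤ logWeight k θ hk (one_lt_of_exp_le hθ) w :=
  mul_log_div_mono hθ (one_sub_pow_mem hk z).1
    (sub_le_sub_left (pow_le_pow_left₀ (norm_nonneg _) h k) 1) (one_sub_pow_mem hk w).2

/-- With `s = 1 - |z|` and `t = 1 - |z|^k` one has `s ≤ t ≤ 2s`; the additive change in the
logarithm is absorbed because `log (3 / s) ≥ 1`. -/
theorem logWeight_le_vlog (z : 𝔻) :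
    logWeight k θ hk (one_lt_of_exp_le hθ) z ≤ 2 * (Real.log θ + 1) * vlog z := by
  rw [logWeight_apply, vlog_apply]
  have hθ0 : 0 < θ := (Real.exp_pos 1).trans_le hθ
  have hs : 0 < 1 - ‖(z : ℂ)‖ := sub_pos.2 z.norm_lt_one
  obtain ⟨h1, h2⟩ := one_sub_le_one_sub_pow hk (norm_nonneg (z : ℂ)) z.norm_lt_one.le
  obtain ⟨h3, h4⟩ := one_sub_pow_mem hk z
  set s := 1 - ‖(z : ℂ)‖
  set t := 1 - ‖(z : ℂ)‖ ^ k
  have hs1 : s ≤ 1 := h1.trans h4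
  have hlogθ : 1 ≤ Real.log θ := (Real.le_log_iff_exp_le hθ0).2 hθ
  have hlog3 : 1 ≤ Real.log 3 := (Real.le_log_iff_exp_le (by norm_num)).2 exp_one_le_three
  have h5 : Real.log (3 / s) = Real.log 3 - Real.log s := Real.log_div (by norm_num) hs.ne'
  have h6 : Real.log (θ / t) ≤ Real.log θ - Real.log s := by
    rw [Real.log_div hθ0.ne' h3.ne']
    linarith [Real.log_le_log hs h1]
  have h7 : Real.log s ≤ 0 := Real.log_nonpos hs.le hs1
  have h8 : Real.log θ - Real.log s ≤ (Real.log θ + 1) * Real.log (3 / s) := by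
    rw [h5]; nlinarith
  calc t * Real.log (θ / t) ≤ t * ((Real.log θ + 1) * Real.log (3 / s)) := by
        gcongr; exact h6.trans h8
    _ ≤ 2 * s * ((Real.log θ + 1) * Real.log (3 / s)) := by
        gcongr
        exact mul_nonneg (by linarith) (by rw [h5]; linarith)
    _ = _ := by ring

theorem vlog_le_logWeight (z : 𝔻) :
    vlog z ≤ 3 * logWeight k θ hk (one_lt_of_exp_le hθ) z := by
  rw [logWeight_apply, vlog_apply]
  have hθ0 : 0 < θ := (Real.exp_pos 1).trans_le hθ
  have hs : 0 < 1 - ‖(z : ℂ)‖ := sub_pos.2 z.norm_lt_one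
  obtain ⟨h1, h2⟩ := one_sub_le_one_sub_pow hk (norm_nonneg (z : ℂ)) z.norm_lt_one.le
  obtain ⟨h3, h4⟩ := one_sub_pow_mem hk z
  set s := 1 - ‖(z : ℂ)‖
  set t := 1 - ‖(z : ℂ)‖ ^ k
  have hlogθ : 1 ≤ Real.log θ := (Real.le_log_iff_exp_le hθ0).2 hθ
  -- From `t ≤ 2s`; then `log 6 ≤ 3 ≤ 3 log θ` absorbs the constant.
  have h5 : Real.log (3 / s) ≤ Real.log (6 / t) := by
    refine Real.log_le_log (by positivity) ?_
    rw [div_le_div_iff₀ hs h3]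
    linarith
  have h6 : Real.log 6 ≤ 3 := by
    rw [Real.log_le_iff_le_exp (by norm_num)]
    have : Real.exp 3 = Real.exp 1 ^ 3 := by rw [← Real.exp_nat_mul]; norm_num
    rw [this]
    have h2e : (2 : ℝ) ≤ Real.exp 1 := by linarith [Real.exp_one_gt_d9]
    calc (6 : ℝ) ≤ 2 ^ 3 := by norm_num
      _ ≤ _ := by gcongr
  have h7 : Real.log t ≤ 0 := Real.log_nonpos h3.le h4
  rw [Real.log_div (by norm_num) h3.ne'] at h5
  have h8 : Real.log (3 / s) ≤ 3 * Real.log (θ / t) := by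
    rw [Real.log_div hθ0.ne' h3.ne']
    linarith
  have h9 : 0 ≤ Real.log (θ / t) := by
    rw [Real.log_div hθ0.ne' h3.ne']; linarith
  calc s * Real.log (3 / s) ≤ s * (3 * Real.log (θ / t)) := by gcongr
    _ ≤ t * (3 * Real.log (θ / t)) := by gcongr
    _ = _ := by ring

theorem exists_logWeight_le {ε : ℝ} (hε : 0 < ε) :
    ∃ ρ < 1, 0 ≤ ρ ∧ ∀ z : 𝔻, ρ ≤ ‖(z : ℂ)‖ → logWeight k θ hk (one_lt_of_exp_le hθ) z ≤ ε := by
  have hθ0 : 0 < θ := (Real.exp_pos 1).trans_le hθ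
  -- The logarithm is split off so that continuity of `x log x` at `0` covers the boundary point `r
  -- = 1`.
  have hcont : Continuous fun r : ℝ =>
      (1 - r ^ k) * Real.log θ - (1 - r ^ k) * Real.log (1 - r ^ k) :=
    (by fun_prop : Continuous fun r : ℝ => (1 - r ^ k) * Real.log θ).sub
      (Real.continuous_mul_log.comp (by fun_prop : Continuous fun r : ℝ => 1 - r ^ k))
  obtain ⟨δ, hδ, h⟩ := Metric.continuous_iff.1 hcont 1 ε hε
  refine ⟨max 0 (1 - δ / 2), max_lt one_pos (by linarith), le_max_left _ _, fun z hz => ?_⟩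
  have h1 : 1 - δ / 2 ≤ ‖(z : ℂ)‖ := (le_max_right _ _).trans hz
  have h2 := z.norm_lt_one
  have h3 := h ‖(z : ℂ)‖ (by rw [Real.dist_eq, abs_lt]; constructor <;> linarith)
  rw [logWeight_apply, Real.log_div hθ0.ne' (one_sub_pow_mem hk z).1.ne', mul_sub]
  simp only [one_pow, sub_self, zero_mul, Real.dist_eq, sub_zero] at h3
  exact (le_abs_self _).trans h3.le

end

/-! ### The norms of the monomials -/

theorem log_add_one_pos {j : ℕ} (hj : 1 ≤ j) : 0 < Real.log ((j : ℝ) + 1) :=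
  Real.log_pos (by have : (1 : ℝ) ≤ j := by exact_mod_cast hj
                   linarith)

theorem log_three_mul_le {j : ℕ} (hj : 1 ≤ j) :
    Real.log (3 * ((j : ℝ) + 1)) ≤ 3 * Real.log ((j : ℝ) + 1) := by
  have hj' : (1 : ℝ) ≤ j := by exact_mod_cast hj
  rw [show 3 * Real.log ((j : ℝ) + 1) = Real.log (((j : ℝ) + 1) ^ 3) by
    rw [Real.log_pow]; norm_num]
  refine Real.log_le_log (by positivity) ?_
  nlinarith [sq_nonneg ((j : ℝ) + 1)]

/-- The inverse of `(1 + 1/m)^m ≤ e`. It keeps `r^m` bounded below at the radii where monomials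
nearly peak. -/
theorem exp_neg_one_le_pow (m : ℕ) : Real.exp (-1) ≤ ((m : ℝ) / (m + 1)) ^ m := by
  rcases Nat.eq_zero_or_pos m with rfl | hm
  · simp
  have hm' : (0 : ℝ) < m := by exact_mod_cast hm
  have h1 : (m : ℝ) / (m + 1) = (1 / (m : ℝ) + 1)⁻¹ := by field_simp; ring
  rw [h1, inv_pow, Real.exp_neg]
  refine inv_anti₀ (by positivity) ?_
  calc (1 / (m : ℝ) + 1) ^ m ≤ Real.exp (1 / (m : ℝ)) ^ m := by
        gcongr; exact Real.add_one_le_exp _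
    _ = Real.exp 1 := by rw [← Real.exp_nat_mul]; congr 1; field_simp

/-- Each term of `1 + r + ⋯ + r^(j-1)` is at least `r^(j-1)`, and the sum times `1 - r` is `1 -
r^j`. -/
theorem natCast_mul_pow_mul_one_sub_le {r : ℝ} (h0 : 0 ≤ r) (h1 : r ≤ 1) (j : ℕ) :
    j * r ^ (j - 1) * (1 - r) ≤ 1 := by
  have h2 : (j : ℝ) * r ^ (j - 1) ≤ ∑ i ∈ Finset.range j, r ^ i := by
    have := Finset.card_nsmul_le_sum (Finset.range j) (fun i => r ^ i) (r ^ (j - 1))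
      fun i hi => pow_le_pow_of_le_one h0 h1 (by have := Finset.mem_range.1 hi; omega)
    simpa using this
  have h3 := geom_sum_mul_neg r j
  have h4 : 0 ≤ r ^ j := by positivity
  have h5 := mul_le_mul_of_nonneg_right h2 (sub_nonneg.2 h1)
  linarith

theorem natCast_mul_pow_mul_vlog_le {j : ℕ} (hj : 1 ≤ j) (z : 𝔻) :
    j * ‖(z : ℂ)‖ ^ (j - 1) * vlog z ≤ 3 * Real.log ((j : ℝ) + 1) := by
  rw [vlog_apply]
  have h0 := norm_nonneg (z : ℂ)
  have h1 := z.norm_lt_one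
  set r := ‖(z : ℂ)‖
  have hs : 0 < 1 - r := sub_pos.2 h1
  have hj' : (0 : ℝ) < (j : ℝ) + 1 := by positivity
  have h3 := log_three_mul_le hj
  have hl := log_add_one_pos hj
  -- Away from the boundary the logarithm is at most `log (3 (j + 1))`. Closer to it, `t log (3 /
  -- t)` is monotone and is compared with its value at `t = 1 / (j + 1)`.
  rcases le_or_gt (1 / ((j : ℝ) + 1)) (1 - r) with hc | hc
  · have h2 : Real.log (3 / (1 - r)) ≤ Real.log (3 * ((j : ℝ) + 1)) := by
      refine Real.log_le_log (by positivity) ?_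
      rw [div_le_iff₀ hs]
      rw [div_le_iff₀ hj'] at hc
      nlinarith
    calc j * r ^ (j - 1) * ((1 - r) * Real.log (3 / (1 - r)))
        = j * r ^ (j - 1) * (1 - r) * Real.log (3 / (1 - r)) := by ring
      _ ≤ j * r ^ (j - 1) * (1 - r) * (3 * Real.log ((j : ℝ) + 1)) := by
          gcongr; exact h2.trans h3
      _ ≤ 1 * (3 * Real.log ((j : ℝ) + 1)) := by
          gcongr; exact natCast_mul_pow_mul_one_sub_le h0 h1.le j
      _ = _ := one_mul _
  · have h2 := mul_log_div_mono exp_one_le_three hs hc.le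
      (by rw [div_le_one hj']; have : (0 : ℝ) ≤ j := by positivity
          linarith)
    rw [div_div_eq_mul_div, div_one] at h2
    have h4 : r ^ (j - 1) ≤ 1 := pow_le_one₀ h0 h1.le
    have h5 : (1 - r) * Real.log (3 / (1 - r)) ≤
        1 / ((j : ℝ) + 1) * (3 * Real.log ((j : ℝ) + 1)) := h2.trans (by gcongr)
    have h6 : 0 ≤ (1 - r) * Real.log (3 / (1 - r)) :=
      mul_nonneg hs.le (Real.log_nonneg (by rw [le_div_iff₀ hs]; linarith))
    calc j * r ^ (j - 1) * ((1 - r) * Real.log (3 / (1 - r)))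
        ≤ j * 1 * (1 / ((j : ℝ) + 1) * (3 * Real.log ((j : ℝ) + 1))) := by
          gcongr
      _ = j / ((j : ℝ) + 1) * (3 * Real.log ((j : ℝ) + 1)) := by ring
      _ ≤ 1 * (3 * Real.log ((j : ℝ) + 1)) := by
          gcongr
          rw [div_le_one hj']; linarith
      _ = _ := one_mul _

/-- For each point of the disc there is a monomial whose derivative is, up to a constant, extremal
there; its degree is large if the point is close to the boundary. -/
theorem exists_log_le_mul_vlog (z : 𝔻) : ∃ j : ℕ, 1 ≤ j ∧ 1 / (1 - ‖(z : ℂ)‖) < j + 1 ∧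
    Real.log ((j : ℝ) + 1) ≤ 6 * (j * ‖(z : ℂ)‖ ^ (j - 1) * vlog z) := by
  rw [vlog_apply]
  have h0 := norm_nonneg (z : ℂ)
  have h1 := z.norm_lt_one
  set r := ‖(z : ℂ)‖
  have hs : 0 < 1 - r := sub_pos.2 h1
  have hinv : 1 ≤ 1 / (1 - r) := by rw [le_div_iff₀ hs]; linarith
  have hj : 1 ≤ ⌊1 / (1 - r)⌋₊ := Nat.le_floor (by simpa using hinv)
  have hj1 : (⌊1 / (1 - r)⌋₊ : ℝ) ≤ 1 / (1 - r) := Nat.floor_le (by positivity)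
  have hj2 : 1 / (1 - r) < (⌊1 / (1 - r)⌋₊ : ℝ) + 1 := Nat.lt_floor_add_one _
  refine ⟨⌊1 / (1 - r)⌋₊, hj, hj2, ?_⟩
  generalize ⌊1 / (1 - r)⌋₊ = j at *
  obtain ⟨m, rfl⟩ := Nat.exists_eq_add_of_le' hj
  rw [Nat.add_sub_cancel]
  push_cast at *
  have hm : (0 : ℝ) < (m : ℝ) + 1 := by positivity
  rw [le_div_iff₀ hs] at hj1
  -- The floor gives `(m + 1) (1 - r) ≤ 1`, where `m + 1` is the degree.
  have hr : (m : ℝ) / (m + 1) ≤ r := by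
    rw [div_le_iff₀ hm]; nlinarith
  have hpow : 1 / 3 ≤ r ^ m := by
    have h2 : (1 : ℝ) / 3 ≤ Real.exp (-1) := by
      rw [Real.exp_neg, one_div]
      exact inv_anti₀ (Real.exp_pos 1) exp_one_le_three
    exact h2.trans ((exp_neg_one_le_pow m).trans (pow_le_pow_left₀ (by positivity) hr m))
  -- From `1 < (m + 2) (1 - r)` and `m + 2 ≤ 2 (m + 1)`. With the bound `1 / 3` for `r ^ m` this
  -- produces the factor 6.
  have hhalf : 1 / 2 ≤ ((m : ℝ) + 1) * (1 - r) := by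
    rw [div_lt_iff₀ hs] at hj2
    nlinarith
  have hlog : Real.log ((m : ℝ) + 1 + 1) ≤ Real.log (3 / (1 - r)) := by
    refine Real.log_le_log (by positivity) ?_
    rw [le_div_iff₀ hs]
    nlinarith
  have hlog0 : 0 ≤ Real.log ((m : ℝ) + 1 + 1) := Real.log_nonneg (by linarith)
  calc Real.log ((m : ℝ) + 1 + 1) ≤ Real.log (3 / (1 - r)) := hlog
    _ = 6 * (1 / 2 * (1 / 3) * Real.log (3 / (1 - r))) := by ring
    _ ≤ 6 * (((m : ℝ) + 1) * (1 - r) * r ^ m * Real.log (3 / (1 - r))) := by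
        gcongr
        exact hlog0.trans hlog
    _ = _ := by ring

theorem blochSeminorm_vlog_monomial_le {j : ℕ} (hj : 1 ≤ j) :
    blochSeminorm vlog (monomial j) ≤ ENNReal.ofReal (3 * Real.log ((j : ℝ) + 1)) := by
  refine (blochSeminorm_le_ofReal_iff (by linarith [log_add_one_pos hj])).2 fun z => ?_
  rw [discDeriv_monomial, norm_mul, norm_pow, Complex.norm_natCast, mul_comm]
  exact natCast_mul_pow_mul_vlog_le hj z

/-- Test at the real point `r = j / (j + 1)`: there `1 - r = 1 / (j + 1)` and `j r^(j-1) (1 - r) =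
r^j ≥ 1/e ≥ 1/3`. -/
theorem le_blochSeminorm_vlog_monomial {j : ℕ} (hj : 1 ≤ j) :
    ENNReal.ofReal (Real.log ((j : ℝ) + 1) / 3) ≤ blochSeminorm vlog (monomial j) := by
  have hj' : (0 : ℝ) < (j : ℝ) + 1 := by positivity
  have hr0 : 0 ≤ (j : ℝ) / (j + 1) := by positivity
  have hr1 : (j : ℝ) / (j + 1) < 1 := by rw [div_lt_one hj']; linarith
  have hn : ‖(((j : ℝ) / (j + 1) : ℝ) : ℂ)‖ = (j : ℝ) / (j + 1) := by
    rw [Complex.norm_real, Real.norm_of_nonneg hr0]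
  have hn1 : ‖(((j : ℝ) / (j + 1) : ℝ) : ℂ)‖ < 1 := hn.trans_lt hr1
  refine le_trans ?_ (le_iSup _ (Complex.UnitDisc.mk _ hn1))
  refine ENNReal.ofReal_le_ofReal ?_
  rw [discDeriv_monomial, norm_mul, norm_pow, Complex.norm_natCast, vlog_apply,
    Complex.UnitDisc.coe_mk, hn]
  have h2 : (1 : ℝ) / 3 ≤ Real.exp (-1) := by
    rw [Real.exp_neg, one_div]
    exact inv_anti₀ (Real.exp_pos 1) exp_one_le_three
  have h3 := h2.trans (exp_neg_one_le_pow j)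
  have h4 : 1 - (j : ℝ) / (j + 1) = 1 / (j + 1) := by field_simp; ring
  have hl := log_add_one_pos hj
  have h5 : Real.log ((j : ℝ) + 1) ≤ Real.log (3 / (1 / ((j : ℝ) + 1))) := by
    refine Real.log_le_log hj' ?_
    rw [div_div_eq_mul_div, div_one]
    linarith
  have h6 : ((j : ℝ) / (j + 1)) ^ j = (j : ℝ) / (j + 1) * ((j : ℝ) / (j + 1)) ^ (j - 1) := by
    rw [← pow_succ', Nat.sub_add_cancel hj]
  rw [h4]
  calc Real.log ((j : ℝ) + 1) / 3 = 1 / 3 * Real.log ((j : ℝ) + 1) := by ring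
    _ ≤ ((j : ℝ) / (j + 1)) ^ j * Real.log (3 / (1 / ((j : ℝ) + 1))) := by gcongr
    _ = _ := by rw [h6]; field_simp

/-- The properties of the logarithmic weights that the theory of composition operators uses:
comparability with `vlog` up to the factor `A`, radial monotonicity, decay at the boundary. -/
structure Weight.IsLogType (ν : Weight) (A : ℝ) : Prop where
  pos : 0 < A
  le_vlog : ∀ z, ν z ≤ A * vlog z
  vlog_le : ∀ z, vlog z ≤ A * ν z
  antitone : ∀ z w : 𝔻, ‖(w : ℂ)‖ ≤ ‖(z : ℂ)‖ → ν z ≤ ν w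
  exists_le : ∀ ε > 0, ∃ ρ < 1, 0 ≤ ρ ∧ ∀ z : 𝔻, ρ ≤ ‖(z : ℂ)‖ → ν z ≤ ε

theorem logWeight_isLogType {k : ℕ} {θ : ℝ} (hk : k = 1 ∨ k = 2) (hθ : Real.exp 1 ≤ θ) :
    (logWeight k θ hk (one_lt_of_exp_le hθ)).IsLogType (2 * (Real.log θ + 1)) := by
  have hlogθ : 1 ≤ Real.log θ :=
    (Real.le_log_iff_exp_le ((Real.exp_pos 1).trans_le hθ)).2 hθ
  refine ⟨by linarith, logWeight_le_vlog hk hθ, fun z => (vlog_le_logWeight hk hθ z).trans ?_,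
    fun z w h => logWeight_antitone hk hθ h, fun ε hε => exists_logWeight_le hk hθ hε⟩
  exact mul_le_mul_of_nonneg_right (by linarith) (Weight.pos' _ z).le

/-! ### The quotients of norms -/

theorem logRatio_le_normRatio (φ : 𝔻 → 𝔻) (μ : Weight) {j : ℕ} (hj : 1 ≤ j) :
    logRatio φ μ j ≤ (3 : ℝ≥0) * normRatio φ μ j := by
  have hl := log_add_one_pos hj
  unfold logRatio normRatio
  refine le_trans ?_ (mul_le_mul_right (ENNReal.div_le_div_left
    (blochSeminorm_vlog_monomial_le hj) _) _)
  rw [ENNReal.ofReal_mul (by norm_num), ← mul_div_assoc]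
  have h3 : ((3 : ℝ≥0) : ℝ≥0∞) = ENNReal.ofReal 3 := by norm_num
  rw [h3, ENNReal.mul_div_mul_left _ _ (by simp) (by simp)]

theorem normRatio_le_logRatio (φ : 𝔻 → 𝔻) (μ : Weight) {j : ℕ} (hj : 1 ≤ j) :
    normRatio φ μ j ≤ (3 : ℝ≥0) * logRatio φ μ j := by
  have hl := log_add_one_pos hj
  unfold logRatio normRatio
  refine (ENNReal.div_le_div_left (le_blochSeminorm_vlog_monomial hj) _).trans ?_
  have h3 : ((3 : ℝ≥0) : ℝ≥0∞) = ENNReal.ofReal 3 := by norm_num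
  have h4 : ENNReal.ofReal (Real.log ((j : ℝ) + 1)) =
      ENNReal.ofReal 3 * ENNReal.ofReal (Real.log ((j : ℝ) + 1) / 3) := by
    rw [← ENNReal.ofReal_mul (by norm_num)]
    congr 1
    ring
  rw [h4, h3, ← mul_div_assoc, ENNReal.mul_div_mul_left _ _ (by simp) (by simp)]

theorem supPos_lt_top_of_le {a b : ℕ → ℝ≥0∞} {K : ℝ≥0} (h : ∀ j, 1 ≤ j → a j ≤ K * b j)
    (hb : supPos b < ∞) : supPos a < ∞ := by
  refine lt_of_le_of_lt ?_ (ENNReal.mul_lt_top (ENNReal.coe_lt_top (r := K)) hb)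
  exact iSup₂_le fun j hj => (h j hj).trans
    (mul_le_mul_right (le_iSup₂ (f := fun (j : ℕ) (_ : 1 ≤ j) => b j) j hj) _)

theorem tendsto_zero_of_le {a b : ℕ → ℝ≥0∞} {K : ℝ≥0} (h : ∀ j, 1 ≤ j → a j ≤ K * b j)
    (hb : Tendsto b atTop (𝓝 0)) : Tendsto a atTop (𝓝 0) := by
  have h1 := ENNReal.Tendsto.const_mul (a := (K : ℝ≥0∞)) hb (Or.inr ENNReal.coe_ne_top)
  rw [mul_zero] at h1
  refine tendsto_of_tendsto_of_tendsto_of_le_of_le' tendsto_const_nhds h1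
    (Eventually.of_forall fun _ => zero_le) ?_
  filter_upwards [eventually_ge_atTop 1] with j hj using h j hj

theorem limsup_le_of_le_mul {a b : ℕ → ℝ≥0∞} {K : ℝ≥0} (h : ∀ j, 1 ≤ j → a j ≤ K * b j) :
    limsup a atTop ≤ K * limsup b atTop := by
  rw [← ENNReal.limsup_const_mul_of_ne_top ENNReal.coe_ne_top]
  refine limsup_le_limsup ?_
  filter_upwards [eventually_ge_atTop 1] with j hj using h j hj

theorem logRatio_le_ofReal_iff {φ : 𝔻 → 𝔻} {μ : Weight} {j : ℕ} (hj : 1 ≤ j) {L : ℝ}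
    (hL : 0 ≤ L) : logRatio φ μ j ≤ ENNReal.ofReal L ↔
      ∀ z, μ z * ‖discDeriv (selfMapPow φ j) z‖ ≤ L * Real.log ((j : ℝ) + 1) := by
  have hl := log_add_one_pos hj
  rw [logRatio, ENNReal.div_le_iff (by simpa using hl) ENNReal.ofReal_ne_top,
    ← ENNReal.ofReal_mul hL, blochSeminorm_le_ofReal_iff (by positivity)]

/-- The quotients `‖φ^j‖_μ / log (j + 1)` with `j ≥ J` control `μ |φ'| / v_log(φ)` where `φ` is
close to the unit circle. -/
theorem mul_norm_discDeriv_le_of_logRatio_le {φ : 𝔻 → 𝔻} {μ : Weight}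
    (hφ : IsHolomorphic fun z => (φ z : ℂ)) {J : ℕ} {L : ℝ} (hL : 0 ≤ L)
    (h : ∀ j, 1 ≤ j → J ≤ j → logRatio φ μ j ≤ ENNReal.ofReal L) (z : 𝔻)
    (hz : (J : ℝ) ≤ 1 / (1 - ‖(φ z : ℂ)‖)) :
    μ z * ‖discDeriv (fun z => (φ z : ℂ)) z‖ ≤ 6 * L * vlog (φ z) := by
  obtain ⟨j, hj, hj1, hj2⟩ := exists_log_le_mul_vlog (φ z)
  have hJ : J ≤ j := by
    have : (J : ℝ) < (j : ℝ) + 1 := hz.trans_lt hj1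
    exact Nat.lt_succ_iff.1 (by exact_mod_cast this)
  have h1 := (logRatio_le_ofReal_iff hj hL).1 (h j hj hJ) z
  rw [norm_discDeriv_selfMapPow hφ] at h1
  have hl := log_add_one_pos hj
  have hv := (vlog.pos' (φ z)).le
  set D := ‖discDeriv (fun z => (φ z : ℂ)) z‖
  have hD : 0 ≤ μ z * D := mul_nonneg (μ.pos' z).le (norm_nonneg _)
  refine le_of_mul_le_mul_right ?_ hl
  calc μ z * D * Real.log ((j : ℝ) + 1)
      ≤ μ z * D * (6 * (j * ‖(φ z : ℂ)‖ ^ (j - 1) * vlog (φ z))) := by gcongr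
    _ = 6 * vlog (φ z) * (μ z * (j * ‖(φ z : ℂ)‖ ^ (j - 1) * D)) := by ring
    _ ≤ 6 * vlog (φ z) * (L * Real.log ((j : ℝ) + 1)) := by gcongr
    _ = _ := by ring

/-! ### Normalized monomials -/

theorem Weight.IsLogType.mul_norm_discDeriv_monomial_le {ν : Weight} {A : ℝ}
    (hν : ν.IsLogType A) {j : ℕ} (hj : 1 ≤ j) (z : 𝔻) :
    ν z * ‖discDeriv (monomial j) z‖ ≤ 3 * A * Real.log ((j : ℝ) + 1) := by
  rw [discDeriv_monomial, norm_mul, norm_pow, Complex.norm_natCast]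
  have h1 := natCast_mul_pow_mul_vlog_le hj z
  have h2 := hν.pos
  calc ν z * (j * ‖(z : ℂ)‖ ^ (j - 1)) ≤ A * vlog z * (j * ‖(z : ℂ)‖ ^ (j - 1)) := by
        gcongr; exact hν.le_vlog z
    _ = A * (j * ‖(z : ℂ)‖ ^ (j - 1) * vlog z) := by ring
    _ ≤ A * (3 * Real.log ((j : ℝ) + 1)) := by gcongr
    _ = _ := by ring

theorem monomial_mem (ν : Weight) (j : ℕ) : monomial j ∈ blochSubmodule ν := by
  refine ⟨monomial_isHolomorphic j, ?_⟩
  obtain ⟨M, hM⟩ := ν.bounded'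
  have hM0 : 0 ≤ M := (ν.pos' 0).le.trans (hM 0)
  refine blochSeminorm_lt_top_of_le (C := M * j) fun z => ?_
  rw [discDeriv_monomial, norm_mul, norm_pow, Complex.norm_natCast]
  have h4 : ‖(z : ℂ)‖ ^ (j - 1) ≤ 1 := pow_le_one₀ (norm_nonneg _) z.norm_lt_one.le
  calc ν z * (j * ‖(z : ℂ)‖ ^ (j - 1)) ≤ M * (j * 1) := by
        gcongr; exact hM z
    _ = _ := by ring

/-- The normalized monomial `z^j / log (j + 1)` (which is `0` for `j = 0`). -/
def normalizedMonomial (ν : Weight) (j : ℕ) : BlochSpace ν :=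
  ((Real.log ((j : ℝ) + 1))⁻¹ : ℂ) • BlochSpace.ofMem (monomial_mem ν j)

theorem norm_discDeriv_smul (c : ℂ) {f : 𝔻 → ℂ} (hf : IsHolomorphic f) (z : 𝔻) :
    ‖discDeriv (c • f) z‖ = ‖c‖ * ‖discDeriv f z‖ := by
  rw [discDeriv_smul c hf, norm_mul]

theorem incl_normalizedMonomial (ν : Weight) (j : ℕ) :
    BlochSpace.incl ν (normalizedMonomial ν j) =
      ((Real.log ((j : ℝ) + 1))⁻¹ : ℂ) • monomial j := rfl

theorem norm_log_inv {j : ℕ} (hj : 1 ≤ j) :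
    ‖((Real.log ((j : ℝ) + 1))⁻¹ : ℂ)‖ = (Real.log ((j : ℝ) + 1))⁻¹ := by
  rw [norm_inv, Complex.norm_real, Real.norm_of_nonneg (log_add_one_pos hj).le]

theorem Weight.IsLogType.mul_norm_discDeriv_normalizedMonomial_le {ν : Weight} {A : ℝ}
    (hν : ν.IsLogType A) {j : ℕ} (hj : 1 ≤ j) (z : 𝔻) :
    ν z * ‖discDeriv (BlochSpace.incl ν (normalizedMonomial ν j)) z‖ ≤ 3 * A := by
  rw [incl_normalizedMonomial, norm_discDeriv_smul _ (monomial_isHolomorphic j), norm_log_inv hj]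
  have hl := log_add_one_pos hj
  have h1 := hν.mul_norm_discDeriv_monomial_le hj z
  calc _ = (Real.log ((j : ℝ) + 1))⁻¹ * (ν z * ‖discDeriv (monomial j) z‖) := by ring
    _ ≤ (Real.log ((j : ℝ) + 1))⁻¹ * (3 * A * Real.log ((j : ℝ) + 1)) := by gcongr
    _ = 3 * A := by field_simp

theorem incl_normalizedMonomial_zero (ν : Weight) {j : ℕ} (hj : 1 ≤ j) :
    BlochSpace.incl ν (normalizedMonomial ν j) 0 = 0 := by
  rw [incl_normalizedMonomial]
  simp [monomial, show j ≠ 0 by omega]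

theorem Weight.IsLogType.norm_normalizedMonomial_le {ν : Weight} {A : ℝ}
    (hν : ν.IsLogType A) {j : ℕ} (hj : 1 ≤ j) : ‖normalizedMonomial ν j‖ ≤ 3 * A := by
  have := (normalizedMonomial ν j).norm_le_add (a := 0) (b := 3 * A)
    (by simp [incl_normalizedMonomial_zero ν hj])
    (hν.mul_norm_discDeriv_normalizedMonomial_le hj)
  linarith

/-- The quotient `‖φ^j‖_μ / log (j + 1)` is at most the norm of the image of the normalized
monomial. -/
theorem logRatio_le_norm_compOp {φ : 𝔻 → 𝔻} {ν μ : Weight} (h : MapsBloch φ ν μ) {j : ℕ}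
    (hj : 1 ≤ j) :
    logRatio φ μ j ≤ ENNReal.ofReal ‖compOp h (normalizedMonomial ν j)‖ := by
  rw [logRatio_le_ofReal_iff hj (norm_nonneg _)]
  intro z
  have h1 := (compOp h (normalizedMonomial ν j)).mul_norm_discDeriv_le z
  have hl := log_add_one_pos hj
  have h2 : BlochSpace.incl μ (compOp h (normalizedMonomial ν j)) =
      ((Real.log ((j : ℝ) + 1))⁻¹ : ℂ) • selfMapPow φ j := rfl
  have h3 : IsHolomorphic (selfMapPow φ j) := (h _ (monomial_mem ν j)).1
  rw [h2, norm_discDeriv_smul _ h3, norm_log_inv hj] at h1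
  calc _ = μ z * ((Real.log ((j : ℝ) + 1))⁻¹ * ‖discDeriv (selfMapPow φ j) z‖) *
        Real.log ((j : ℝ) + 1) := by field_simp
    _ ≤ _ := by gcongr

/-! ### Boundedness -/

theorem mapsBloch_of_mul_le {φ : 𝔻 → 𝔻} {ν μ : Weight} (hφ : IsHolomorphic fun z => (φ z : ℂ))
    {C : ℝ} (h : ∀ z, μ z * ‖discDeriv (fun z => (φ z : ℂ)) z‖ ≤ C * ν (φ z)) :
    MapsBloch φ ν μ := by
  have hC : 0 ≤ C := by
    have := (mul_nonneg (μ.pos' 0).le (norm_nonneg _)).trans (h 0)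
    exact nonneg_of_mul_nonneg_left this (ν.pos' _)
  intro f hf
  refine ⟨hf.1.comp_selfMap hφ, blochSeminorm_lt_top_of_le
    (C := C * ‖BlochSpace.ofMem hf‖) fun z => ?_⟩
  have h1 := (BlochSpace.ofMem hf).mul_norm_discDeriv_le (φ z)
  rw [BlochSpace.incl_ofMem] at h1
  rw [discDeriv_comp_selfMap hf.1 hφ, norm_mul]
  calc _ = μ z * ‖discDeriv (fun z => (φ z : ℂ)) z‖ * ‖discDeriv f (φ z)‖ := by ring
    _ ≤ C * ν (φ z) * ‖discDeriv f (φ z)‖ :=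
        mul_le_mul_of_nonneg_right (h z) (norm_nonneg _)
    _ = C * (ν (φ z) * ‖discDeriv f (φ z)‖) := by ring
    _ ≤ _ := by gcongr

theorem Weight.IsLogType.supPos_logRatio_lt_top {ν : Weight} {A : ℝ} (hν : ν.IsLogType A)
    {φ : 𝔻 → 𝔻} {μ : Weight} (h : MapsBloch φ ν μ) : supPos (logRatio φ μ) < ∞ := by
  set T : BlochSpace ν →L[ℂ] BlochSpace μ := ⟨compOp h, continuous_compOp h⟩
  refine lt_of_le_of_lt (iSup₂_le fun j hj => ?_)
    (ENNReal.ofReal_lt_top (r := ‖T‖ * (3 * A)))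
  refine (logRatio_le_norm_compOp h hj).trans (ENNReal.ofReal_le_ofReal ?_)
  exact T.le_opNorm_of_le (hν.norm_normalizedMonomial_le hj)

theorem Weight.IsLogType.mapsBloch_of_supPos_lt_top {ν : Weight} {A : ℝ} (hν : ν.IsLogType A)
    {φ : 𝔻 → 𝔻} {μ : Weight} (hφ : IsHolomorphic fun z => (φ z : ℂ))
    (h : supPos (logRatio φ μ) < ∞) : MapsBloch φ ν μ := by
  set L := (supPos (logRatio φ μ)).toReal with hLdef
  have hL : 0 ≤ L := ENNReal.toReal_nonneg
  refine mapsBloch_of_mul_le hφ (C := 6 * L * A) fun z => ?_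
  have hz : 0 < 1 - ‖(φ z : ℂ)‖ := sub_pos.2 (φ z).norm_lt_one
  -- With `J = 0` the restriction to points where `φ` is near the circle is void.
  have h1 := mul_norm_discDeriv_le_of_logRatio_le hφ (J := 0) hL (fun j hj _ => by
    rw [hLdef, ENNReal.ofReal_toReal h.ne]
    exact le_iSup₂ (f := fun (j : ℕ) (_ : 1 ≤ j) => logRatio φ μ j) j hj) z
    (by simpa using hz.le)
  have h2 := mul_le_mul_of_nonneg_left (hν.vlog_le (φ z)) (by positivity : 0 ≤ 6 * L)
  linarith

/-! ### Compact operators and the normalized monomials -/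

theorem norm_discDeriv_normalizedMonomial_le (ν : Weight) {j : ℕ} (hj : 1 ≤ j) (z : 𝔻) :
    ‖discDeriv (BlochSpace.incl ν (normalizedMonomial ν j)) z‖ ≤
      2 * (j * ‖(z : ℂ)‖ ^ (j - 1)) := by
  have hl := log_add_one_pos hj
  have h2 : (1 : ℝ) / 2 ≤ Real.log ((j : ℝ) + 1) := by
    have hj' : (1 : ℝ) ≤ j := by exact_mod_cast hj
    have := Real.log_le_log (by norm_num : (0 : ℝ) < 2) (by linarith : (2 : ℝ) ≤ (j : ℝ) + 1)
    linarith [Real.log_two_gt_d9]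
  rw [incl_normalizedMonomial, norm_discDeriv_smul _ (monomial_isHolomorphic j), norm_log_inv hj,
    discDeriv_monomial, norm_mul, norm_pow, Complex.norm_natCast]
  gcongr
  rw [inv_le_comm₀ hl (by norm_num)]
  linarith

/-- Since `j ρ^(j-1) → 0`, the normalized monomials leave every smaller disc; this is one half of
the gliding hump. -/
theorem eventually_mul_norm_discDeriv_normalizedMonomial_le (ν : Weight) {ρ ε : ℝ} (hρ0 : 0 ≤ ρ)
    (hρ : ρ < 1) (hε : 0 < ε) : ∀ᶠ j in atTop, ∀ z : 𝔻, ‖(z : ℂ)‖ ≤ ρ →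
      ν z * ‖discDeriv (BlochSpace.incl ν (normalizedMonomial ν j)) z‖ ≤ ε := by
  obtain ⟨M, hM⟩ := ν.bounded'
  have hM0 : 0 ≤ M := (ν.pos' 0).le.trans (hM 0)
  have ht : Tendsto (fun j : ℕ => M * (2 * ((j : ℝ) * ρ ^ (j - 1)))) atTop (𝓝 0) := by
    have h1 : Tendsto (fun j : ℕ => (j : ℝ) * ρ ^ (j - 1)) atTop (𝓝 0) := by
      rw [← tendsto_add_atTop_iff_nat 1]
      have := (tendsto_self_mul_const_pow_of_lt_one hρ0 hρ).add
        (tendsto_pow_atTop_nhds_zero_of_lt_one hρ0 hρ)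
      rw [add_zero] at this
      refine this.congr fun n => ?_
      rw [Nat.add_sub_cancel]
      push_cast
      ring
    simpa using (h1.const_mul 2).const_mul M
  filter_upwards [ht.eventually_le_const hε, eventually_ge_atTop 1] with j hj hj1 z hz
  refine le_trans ?_ hj
  have h1 := norm_discDeriv_normalizedMonomial_le ν hj1 z
  calc _ ≤ M * (2 * (j * ‖(z : ℂ)‖ ^ (j - 1))) := by
        gcongr; exact hM z
    _ ≤ _ := by gcongr

section

variable {ν : Weight} {A : ℝ} {Y : Type*} [NormedAddCommGroup Y] [NormedSpace ℂ Y]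

/-- If an operator takes infinitely many normalized monomials close to `h`, then long sums of such
monomials can be chosen with a norm that grows slowly. -/
theorem Weight.IsLogType.exists_sum_normalizedMonomial (hν : ν.IsLogType A)
    (S : BlochSpace ν →L[ℂ] Y) (h : Y) {ε : ℝ} (hε : 0 < ε)
    (hP : ∃ᶠ j in atTop, ‖S (normalizedMonomial ν j) - h‖ ≤ ε) (N : ℕ) :
    ∃ G : BlochSpace ν, BlochSpace.incl ν G 0 = 0 ∧
      (∀ z, ν z * ‖discDeriv (BlochSpace.incl ν G) z‖ ≤ 3 * A + N * ε) ∧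
      (∃ D, ∀ z, ‖discDeriv (BlochSpace.incl ν G) z‖ ≤ D) ∧ ‖S G - (N : ℂ) • h‖ ≤ N * ε := by
  induction N with
  | zero =>
    refine ⟨0, by simp, fun z => ?_, ⟨0, fun z => ?_⟩, by simp⟩ <;>
      simp [discDeriv, extendZero_zero, hν.pos.le]
  | succ N ih =>
    obtain ⟨G, hG0, hG, ⟨D, hD⟩, hSG⟩ := ih
    have hD0 : 0 ≤ D := (norm_nonneg _).trans (hD 0)
    -- Beyond `ρ` the sum so far contributes at most `ε`, thanks to the unweighted bound `D` carried
    -- by the induction. The next degree is then taken so large that its monomial contributes at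
    -- most `ε` inside `ρ`, so the total grows by only `ε`.
    obtain ⟨ρ, hρ, hρ0, hνρ⟩ := hν.exists_le (ε / (D + 1)) (by positivity)
    obtain ⟨j, hj, hjρ, hj1⟩ := (hP.and_eventually
      ((eventually_mul_norm_discDeriv_normalizedMonomial_le ν hρ0 hρ hε).and
        (eventually_ge_atTop 1))).exists
    have hder : ∀ z, ‖discDeriv (BlochSpace.incl ν (G + normalizedMonomial ν j)) z‖ ≤
        ‖discDeriv (BlochSpace.incl ν G) z‖ +
          ‖discDeriv (BlochSpace.incl ν (normalizedMonomial ν j)) z‖ := fun z => by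
      rw [map_add, discDeriv_add G.holo (normalizedMonomial ν j).holo]
      exact norm_add_le _ _
    refine ⟨G + normalizedMonomial ν j, ?_, fun z => ?_, ⟨D + 2 * (j * 1), fun z => ?_⟩, ?_⟩
    · rw [map_add, Pi.add_apply, hG0, incl_normalizedMonomial_zero ν hj1, add_zero]
    · refine (mul_le_mul_of_nonneg_left (hder z) (ν.pos' z).le).trans ?_
      rw [mul_add]
      push_cast
      rcases le_total ‖(z : ℂ)‖ ρ with hz | hz
      · linarith [hG z, hjρ z hz]
      · have h1 : ν z * ‖discDeriv (BlochSpace.incl ν G) z‖ ≤ ε := by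
          calc _ ≤ ε / (D + 1) * (D + 1) := by
                gcongr
                · exact hνρ z hz
                · linarith [hD z]
            _ = ε := by field_simp
        have h2 := hν.mul_norm_discDeriv_normalizedMonomial_le hj1 z
        have h3 : 0 ≤ (N : ℝ) * ε := by positivity
        linarith
    · refine (hder z).trans (add_le_add (hD z)
        ((norm_discDeriv_normalizedMonomial_le ν hj1 z).trans ?_))
      gcongr
      exact pow_le_one₀ (norm_nonneg _) z.norm_lt_one.le
    · have h1 : S (G + normalizedMonomial ν j) - ((N + 1 : ℕ) : ℂ) • h =
          (S G - (N : ℂ) • h) + (S (normalizedMonomial ν j) - h) := by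
        push_cast
        rw [map_add, add_smul, one_smul]
        abel
      rw [h1]
      refine (norm_add_le _ _).trans ?_
      push_cast
      linarith

/-- The sum `G` of `N` monomials gives `N ‖h‖ ≤ ‖S‖ (3A + Nε) + Nε`. With `ε (1 + ‖S‖) = ‖h‖ / 2`
this reads `N ‖h‖ / 2 ≤ 3A ‖S‖`, false for large `N`. -/
theorem Weight.IsLogType.eq_zero_of_frequently (hν : ν.IsLogType A)
    (S : BlochSpace ν →L[ℂ] Y) (h : Y)
    (hP : ∀ ε > 0, ∃ᶠ j in atTop, ‖S (normalizedMonomial ν j) - h‖ ≤ ε) : h = 0 := by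
  by_contra hne
  have hh : 0 < ‖h‖ := norm_pos_iff.2 hne
  set ε := ‖h‖ / (2 * (1 + ‖S‖)) with hεdef
  have hε : 0 < ε := by positivity
  have hε2 : ε * (1 + ‖S‖) = ‖h‖ / 2 := by rw [hεdef]; field_simp
  obtain ⟨N, hN⟩ := exists_nat_gt (‖S‖ * (3 * A) / (‖h‖ / 2))
  rw [div_lt_iff₀ (by positivity)] at hN
  obtain ⟨G, hG0, hG, -, hSG⟩ := hν.exists_sum_normalizedMonomial S h hε (hP ε hε) N
  have h1 : ‖G‖ ≤ 0 + (3 * A + N * ε) := G.norm_le_add (by simp [hG0]) hG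
  have h2 : ‖S G‖ ≤ ‖S‖ * (0 + (3 * A + N * ε)) := S.le_opNorm_of_le h1
  have h3 : (N : ℝ) * ‖h‖ = ‖(N : ℂ) • h‖ := by rw [norm_smul, Complex.norm_natCast]
  have h4 : ‖(N : ℂ) • h‖ ≤ ‖S G‖ + ‖S G - (N : ℂ) • h‖ := by
    have := norm_sub_le (S G) (S G - (N : ℂ) • h)
    rwa [sub_sub_cancel] at this
  have h5 : (N : ℝ) * (ε * (1 + ‖S‖)) = N * (‖h‖ / 2) := by rw [hε2]
  nlinarith

/-- A compact operator takes the normalized monomials to a null sequence. -/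
theorem Weight.IsLogType.tendsto_normalizedMonomial (hν : ν.IsLogType A)
    {S : BlochSpace ν →L[ℂ] Y} (hS : IsCompactOperator S) :
    Tendsto (fun j => S (normalizedMonomial ν j)) atTop (𝓝 0) := by
  by_contra hcon
  rw [Metric.tendsto_atTop] at hcon
  push Not at hcon
  obtain ⟨δ, hδ, hfreq⟩ := hcon
  have hf : ∃ᶠ j in atTop, δ ≤ ‖S (normalizedMonomial ν j)‖ ∧ 1 ≤ j := by
    refine Frequently.and_eventually (frequently_atTop.2 fun a => ?_) (eventually_ge_atTop 1)
    obtain ⟨n, hn, hn'⟩ := hfreq a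
    exact ⟨n, hn, by simpa using hn'⟩
  obtain ⟨p, hp, hpj⟩ := extraction_of_frequently_atTop hf
  have hK := IsCompactOperator.isCompact_closure_image_closedBall
    (f := (S : BlochSpace ν →ₗ[ℂ] Y)) hS (3 * A)
  obtain ⟨h, -, q, hq, hlim⟩ := hK.tendsto_subseq (x := fun n => S (normalizedMonomial ν (p n)))
    fun n => subset_closure ⟨_, by
      simpa using hν.norm_normalizedMonomial_le (hpj n).2, rfl⟩
  -- Compactness supplies a subsequential limit `h`; it must vanish, although the images have norm
  -- at least `δ`.
  have hh0 : h = 0 := by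
    refine hν.eq_zero_of_frequently S h fun ε hε => ?_
    refine (hp.comp hq).tendsto_atTop.frequently (Eventually.frequently ?_)
    filter_upwards [Metric.tendsto_nhds.1 hlim ε hε] with n hn
    rw [dist_eq_norm] at hn
    exact hn.le
  have h1 : δ ≤ ‖h‖ := ge_of_tendsto hlim.norm (Eventually.of_forall fun n => (hpj (q n)).1)
  rw [hh0, norm_zero] at h1
  linarith

end

/-- The lower bound for the essential norm. -/
theorem Weight.IsLogType.limsup_logRatio_le {ν μ : Weight} {A : ℝ} (hν : ν.IsLogType A)
    {φ : 𝔻 → 𝔻} (h : MapsBloch φ ν μ) {S : BlochSpace ν →L[ℂ] BlochSpace μ}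
    (hS : IsCompactOperator S) :
    limsup (logRatio φ μ) atTop ≤ ENNReal.ofReal
      (‖(⟨compOp h, continuous_compOp h⟩ : BlochSpace ν →L[ℂ] BlochSpace μ) - S‖ * (3 * A)) := by
  set T : BlochSpace ν →L[ℂ] BlochSpace μ := ⟨compOp h, continuous_compOp h⟩
  have h1 : Tendsto (fun j => ENNReal.ofReal (‖T - S‖ * (3 * A) + ‖S (normalizedMonomial ν j)‖))
      atTop (𝓝 (ENNReal.ofReal (‖T - S‖ * (3 * A)))) := by
    refine ENNReal.tendsto_ofReal ?_
    simpa using (hν.tendsto_normalizedMonomial hS).norm.const_add (‖T - S‖ * (3 * A))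
  rw [← h1.limsup_eq]
  refine limsup_le_limsup ?_
  filter_upwards [eventually_ge_atTop 1] with j hj
  refine (logRatio_le_norm_compOp h hj).trans (ENNReal.ofReal_le_ofReal ?_)
  have h2 : compOp h (normalizedMonomial ν j) =
      (T - S) (normalizedMonomial ν j) + S (normalizedMonomial ν j) := by
    rw [sub_apply, sub_add_cancel]
    rfl
  rw [h2]
  exact (norm_add_le _ _).trans (add_le_add_left
    ((T - S).le_opNorm_of_le (hν.norm_normalizedMonomial_le hj)) _)

/-! ### Finite rank approximation -/

/-- The Taylor coefficients of the derivative, as a linear map. -/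
def BlochSpace.coeffₗ (ν : Weight) (n : ℕ) : BlochSpace ν →ₗ[ℂ] ℂ where
  toFun f := (n.factorial : ℂ)⁻¹ * iteratedDeriv (n + 1) (extendZero (BlochSpace.incl ν f)) 0
  map_add' f g := by
    have hc : ∀ f : BlochSpace ν, ContDiffAt ℂ (n + 1 : ℕ) (extendZero (BlochSpace.incl ν f)) 0 :=
      fun f => (DifferentiableOn.analyticAt f.holo
        (Metric.isOpen_ball.mem_nhds (by simp))).contDiffAt
    rw [map_add, extendZero_add, iteratedDeriv_add (hc f) (hc g), mul_add]
  map_smul' c f := by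
    rw [map_smul, extendZero_smul, iteratedDeriv_const_smul_field]
    simp only [RingHom.id_apply, smul_eq_mul]
    ring

theorem BlochSpace.coeffₗ_eq {ν : Weight} (n : ℕ) (f : BlochSpace ν) :
    BlochSpace.coeffₗ ν n f = (n.factorial : ℂ)⁻¹ *
      iteratedDeriv n (deriv (extendZero (BlochSpace.incl ν f))) 0 := by
  rw [← iteratedDeriv_succ']
  rfl

theorem IsHolomorphic.differentiableOn_deriv {f : 𝔻 → ℂ} (hf : IsHolomorphic f) :
    DifferentiableOn ℂ (deriv (extendZero f)) (Metric.ball 0 1) :=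
  DifferentiableOn.deriv hf Metric.isOpen_ball

theorem BlochSpace.hasSum_coeffₗ {ν : Weight} (f : BlochSpace ν) (z : 𝔻) :
    HasSum (fun n => BlochSpace.coeffₗ ν n f * (z : ℂ) ^ n)
      (discDeriv (BlochSpace.incl ν f) z) := by
  have := Complex.hasSum_taylorSeries_on_ball f.holo.differentiableOn_deriv (coe_mem_ball z)
  refine this.congr_fun ?_
  intro n
  rw [BlochSpace.coeffₗ_eq, sub_zero, smul_eq_mul, smul_eq_mul]
  ring

/-- Cauchy's estimate for `f'` on the circle of radius `R`, where the lower bound `m` of `ν` gives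
`|f'| ≤ ‖f‖ / m`. -/
theorem BlochSpace.exists_norm_coeffₗ_le (ν : Weight) {R : ℝ} (hR0 : 0 < R) (hR : R < 1) :
    ∃ B, 0 ≤ B ∧ ∀ (n : ℕ) (f : BlochSpace ν), ‖BlochSpace.coeffₗ ν n f‖ ≤ B / R ^ n * ‖f‖ := by
  obtain ⟨m, hm, hmz⟩ := ν.exists_lower_bound hR
  refine ⟨1 / m, by positivity, fun n f => ?_⟩
  have h1 := Complex.norm_iteratedDeriv_le_of_forall_mem_sphere_norm_le (C := ‖f‖ / m) n hR0
    (f.holo.differentiableOn_deriv.diffContOnCl_ball (Metric.closedBall_subset_ball hR))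
    (fun w hw => by
      have hw' : ‖w‖ = R := by simpa using hw
      rw [le_div_iff₀ hm, mul_comm]
      exact (mul_le_mul_of_nonneg_right (hmz (Complex.UnitDisc.mk w (hw'.trans_lt hR)) hw'.le)
        (norm_nonneg _)).trans (f.mul_norm_discDeriv_le (Complex.UnitDisc.mk w (hw'.trans_lt hR))))
  rw [BlochSpace.coeffₗ_eq, norm_mul, norm_inv, Complex.norm_natCast]
  have hf : (0 : ℝ) < n.factorial := by exact_mod_cast n.factorial_pos
  calc _ ≤ (n.factorial : ℝ)⁻¹ * (n.factorial * (‖f‖ / m) / R ^ n) := by gcongr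
    _ = _ := by field_simp

/-- The Taylor coefficients of the derivative, as continuous functionals. -/
def BlochSpace.coeff (ν : Weight) (n : ℕ) : BlochSpace ν →L[ℂ] ℂ :=
  (BlochSpace.coeffₗ ν n).mkContinuousOfExistsBound (by
    obtain ⟨B, -, hB⟩ := BlochSpace.exists_norm_coeffₗ_le ν (R := 1 / 2) (by norm_num)
      (by norm_num)
    exact ⟨_, hB n⟩)

theorem BlochSpace.coeff_apply (ν : Weight) (n : ℕ) (f : BlochSpace ν) :
    BlochSpace.coeff ν n f = BlochSpace.coeffₗ ν n f := rfl

/-- The point `r z` of the disc. -/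
def dilate {r : ℝ} (hr0 : 0 < r) (hr1 : r < 1) (z : 𝔻) : 𝔻 :=
  Complex.UnitDisc.mk (r * z) (by
    rw [norm_mul, Complex.norm_real, Real.norm_of_nonneg hr0.le]
    exact mul_lt_one_of_nonneg_of_lt_one_left hr0.le hr1 z.norm_lt_one.le)

theorem coe_dilate {r : ℝ} (hr0 : 0 < r) (hr1 : r < 1) (z : 𝔻) :
    (dilate hr0 hr1 z : ℂ) = r * z := rfl

theorem norm_dilate_le {r : ℝ} (hr0 : 0 < r) (hr1 : r < 1) (z : 𝔻) :
    ‖(dilate hr0 hr1 z : ℂ)‖ ≤ ‖(z : ℂ)‖ := by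
  rw [coe_dilate, norm_mul, Complex.norm_real, Real.norm_of_nonneg hr0.le]
  exact mul_le_of_le_one_left (norm_nonneg _) hr1.le

theorem BlochSpace.hasSum_dilate {ν : Weight} (f : BlochSpace ν) {r : ℝ} (hr0 : 0 < r)
    (hr1 : r < 1) (z : 𝔻) :
    HasSum (fun n => (r : ℂ) ^ (n + 1) * BlochSpace.coeff ν n f * (z : ℂ) ^ n)
      (r * discDeriv (BlochSpace.incl ν f) (dilate hr0 hr1 z)) := by
  refine ((f.hasSum_coeffₗ (dilate hr0 hr1 z)).mul_left (r : ℂ)).congr_fun fun n => ?_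
  rw [coe_dilate, BlochSpace.coeff_apply]
  ring

/-- Dilation by `1 - η` changes the `n`-th coefficient of `f'` by a factor `1 - (1 - η)^(n+1) ≤ (n +
1) η` (Bernoulli), and `∑ (n + 1) (ρ / R)^n` converges for `ρ < R`. -/
theorem BlochSpace.exists_dilate_close (ν : Weight) {ρ ε : ℝ} (hρ0 : 0 ≤ ρ) (hρ : ρ < 1)
    (hε : 0 < ε) : ∃ (r : ℝ) (hr0 : 0 < r) (hr1 : r < 1), ∀ (f : BlochSpace ν) (z : 𝔻),
      ‖(z : ℂ)‖ ≤ ρ → ‖discDeriv (BlochSpace.incl ν f) z -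
        r * discDeriv (BlochSpace.incl ν f) (dilate hr0 hr1 z)‖ ≤ ε * ‖f‖ := by
  obtain ⟨R, hρR, hR1⟩ := exists_between hρ
  have hR0 : 0 < R := hρ0.trans_lt hρR
  obtain ⟨B, hB0, hB⟩ := BlochSpace.exists_norm_coeffₗ_le ν hR0 hR1
  obtain ⟨q, hq⟩ : ∃ q, q = ρ / R := ⟨_, rfl⟩
  have hq0 : 0 ≤ q := hq ▸ by positivity
  have hq1 : q < 1 := by rwa [hq, div_lt_one hR0]
  have hs : Summable fun n : ℕ => ((n : ℝ) + 1) * q ^ n := by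
    have h1 := (summable_pow_mul_geometric_of_norm_lt_one 1
      (by rwa [Real.norm_of_nonneg hq0] : ‖q‖ < 1)).add (summable_geometric_of_lt_one hq0 hq1)
    refine h1.congr fun n => ?_
    ring
  set T := ∑' n : ℕ, ((n : ℝ) + 1) * q ^ n with hT
  have hT0 : 0 ≤ T := tsum_nonneg fun n => by positivity
  -- The first bound keeps `1 - η` in `(0, 1)`; the second gives `η B T ≤ ε`.
  set η := min (1 / 2) (ε / (B * T + 1)) with hη
  have hη0 : 0 < η := lt_min (by norm_num) (by positivity)
  have hη1 : η ≤ 1 / 2 := min_le_left _ _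
  have hη2 : η * (B * T) ≤ ε := by
    have h1 : η ≤ ε / (B * T + 1) := min_le_right _ _
    rw [le_div_iff₀ (by positivity)] at h1
    linarith
  refine ⟨1 - η, by linarith, by linarith, fun f z hz => ?_⟩
  have hsum := (f.hasSum_coeffₗ z).sub
    (f.hasSum_dilate (by linarith : 0 < 1 - η) (by linarith) z)
  rw [← hsum.tsum_eq]
  have hdom : HasSum (fun n : ℕ => η * B * ‖f‖ * (((n : ℝ) + 1) * q ^ n))
      (η * B * ‖f‖ * T) := hs.hasSum.mul_left _
  refine (tsum_of_norm_bounded hdom fun n => ?_).trans ?_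
  · have h1 : BlochSpace.coeffₗ ν n f * (z : ℂ) ^ n -
        ((1 - η : ℝ) : ℂ) ^ (n + 1) * BlochSpace.coeff ν n f * (z : ℂ) ^ n =
        ((1 - (1 - η) ^ (n + 1) : ℝ) : ℂ) * (BlochSpace.coeffₗ ν n f * (z : ℂ) ^ n) := by
      rw [BlochSpace.coeff_apply]
      push_cast
      ring
    have h2 : 0 ≤ 1 - (1 - η) ^ (n + 1) :=
      sub_nonneg.2 (pow_le_one₀ (by linarith) (by linarith))
    have h3 : 1 - (1 - η) ^ (n + 1) ≤ ((n : ℝ) + 1) * η := by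
      have := one_add_mul_le_pow (by linarith : (-2 : ℝ) ≤ -η) (n + 1)
      push_cast at this
      rw [← sub_eq_add_neg] at this
      linarith
    rw [h1, norm_mul, norm_mul, norm_pow, Complex.norm_real, Real.norm_of_nonneg h2]
    calc _ ≤ ((n : ℝ) + 1) * η * (B / R ^ n * ‖f‖ * ρ ^ n) := by
          gcongr
          exact hB n f
      _ = _ := by rw [hq, div_pow]; ring
  · calc η * B * ‖f‖ * T = η * (B * T) * ‖f‖ := by ring
      _ ≤ _ := by gcongr

/-- After dilation the coefficients decay like `(r / R)^n` with `r < R < 1`, so the Taylor tail is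
small on the whole disc, uniformly over the unit ball. -/
theorem BlochSpace.exists_taylor_close (ν : Weight) {r ε : ℝ} (hr0 : 0 < r) (hr1 : r < 1)
    (hε : 0 < ε) : ∃ N : ℕ, ∀ (f : BlochSpace ν) (z : 𝔻),
      ‖r * discDeriv (BlochSpace.incl ν f) (dilate hr0 hr1 z) -
        ∑ n ∈ Finset.range N, (r : ℂ) ^ (n + 1) * BlochSpace.coeff ν n f * (z : ℂ) ^ n‖ ≤
          ε * ‖f‖ := by
  obtain ⟨R, hrR, hR1⟩ := exists_between hr1
  have hR0 : 0 < R := hr0.trans hrR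
  obtain ⟨B, hB0, hB⟩ := BlochSpace.exists_norm_coeffₗ_le ν hR0 hR1
  obtain ⟨q, hq⟩ : ∃ q, q = r / R := ⟨_, rfl⟩
  have hq1 : q < 1 := by rwa [hq, div_lt_one hR0]
  have hq0 : 0 ≤ q := hq ▸ by positivity
  have ht : Tendsto (fun N : ℕ => B * q ^ N / (1 - q)) atTop (𝓝 0) := by
    simpa using ((tendsto_pow_atTop_nhds_zero_of_lt_one hq0 hq1).const_mul B).div_const (1 - q)
  obtain ⟨N, hN⟩ := (ht.eventually_le_const hε).exists
  refine ⟨N, fun f z => ?_⟩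
  rw [norm_sub_rev]
  refine (norm_sub_le_of_geometric_bound_of_hasSum (C := B * ‖f‖) hq1 (fun n => ?_)
    (f.hasSum_dilate hr0 hr1 z) N).trans ?_
  · rw [norm_mul, norm_mul, norm_pow, norm_pow, Complex.norm_real, Real.norm_of_nonneg hr0.le]
    have h1 : r ^ (n + 1) ≤ r ^ n := pow_le_pow_of_le_one hr0.le hr1.le (Nat.le_succ n)
    have h2 : ‖(z : ℂ)‖ ^ n ≤ 1 := pow_le_one₀ (norm_nonneg _) z.norm_lt_one.le
    have h3 : ‖BlochSpace.coeff ν n f‖ ≤ B / R ^ n * ‖f‖ := hB n f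
    calc _ ≤ r ^ n * (B / R ^ n * ‖f‖) * 1 := by gcongr
      _ = _ := by rw [hq, div_pow]; ring
  · calc B * ‖f‖ * q ^ N / (1 - q) = B * q ^ N / (1 - q) * ‖f‖ := by ring
      _ ≤ _ := by gcongr

/-- The derivative at a point of the disc, as a linear functional on the Bloch space. -/
def BlochSpace.derivₗ (μ : Weight) (z : 𝔻) : BlochSpace μ →ₗ[ℂ] ℂ where
  toFun f := discDeriv (BlochSpace.incl μ f) z
  map_add' f g := by rw [map_add, discDeriv_add f.holo g.holo]
  map_smul' c f := by rw [map_smul, discDeriv_smul c f.holo]; rfl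

theorem isCompactOperator_smulRight {X Y : Type*} [NormedAddCommGroup X] [NormedSpace ℂ X]
    [NormedAddCommGroup Y] [NormedSpace ℂ Y] (g : X →L[ℂ] ℂ) (y : Y) :
    IsCompactOperator (g.smulRight y) :=
  (isCompactOperator_of_locallyCompactSpace_dom g).clm_comp
    ((ContinuousLinearMap.id ℂ ℂ).smulRight y)

theorem isCompactOperator_sum {X Y ι : Type*} [NormedAddCommGroup X] [NormedSpace ℂ X]
    [NormedAddCommGroup Y] [NormedSpace ℂ Y] (s : Finset ι) (S : ι → X →L[ℂ] Y)
    (h : ∀ i, IsCompactOperator (S i)) : IsCompactOperator (∑ i ∈ s, S i : X →L[ℂ] Y) := by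
  classical
  induction s using Finset.induction_on with
  | empty => exact isCompactOperator_zero
  | insert i s hi ih =>
    rw [Finset.sum_insert hi]
    exact (h i).add ih

/-- The finite rank operator that takes `f` to the composition with `φ` of the Taylor polynomial of
the dilation of `f`, up to a constant function that corrects the value at `0`. -/
def taylorComp {φ : 𝔻 → 𝔻} {ν μ : Weight} (h : MapsBloch φ ν μ) (r : ℝ) (N : ℕ) :
    BlochSpace ν →L[ℂ] BlochSpace μ :=
  (BlochSpace.eval ν (φ 0)).smulRight (BlochSpace.ofMem (monomial_mem μ 0)) +
    -- Each term is the primitive of `r^(n+1) a_n w^n` that vanishes at `w = φ 0`, composed with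
    -- `φ`.
    ∑ n ∈ Finset.range N, (BlochSpace.coeff ν n).smulRight
      (((r : ℂ) ^ (n + 1) / (n + 1)) •
        (compOp h (BlochSpace.ofMem (monomial_mem ν (n + 1))) -
          (φ 0 : ℂ) ^ (n + 1) • BlochSpace.ofMem (monomial_mem μ 0)))

theorem isCompactOperator_taylorComp {φ : 𝔻 → 𝔻} {ν μ : Weight} (h : MapsBloch φ ν μ) (r : ℝ)
    (N : ℕ) : IsCompactOperator (taylorComp h r N) :=
  (isCompactOperator_smulRight _ _).add
    (isCompactOperator_sum _ _ fun _ => isCompactOperator_smulRight _ _)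

theorem incl_taylorComp_zero {φ : 𝔻 → 𝔻} {ν μ : Weight} (h : MapsBloch φ ν μ) (r : ℝ) (N : ℕ)
    (f : BlochSpace ν) :
    BlochSpace.incl μ (taylorComp h r N f) 0 = BlochSpace.incl ν f (φ 0) := by
  simp [taylorComp, monomial]

theorem derivₗ_compOp {φ : 𝔻 → 𝔻} {ν μ : Weight} (hφ : IsHolomorphic fun z => (φ z : ℂ))
    (h : MapsBloch φ ν μ) (f : BlochSpace ν) (z : 𝔻) :
    BlochSpace.derivₗ μ z (compOp h f) =
      discDeriv (BlochSpace.incl ν f) (φ z) * discDeriv (fun z => (φ z : ℂ)) z :=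
  discDeriv_comp_selfMap f.holo hφ z

theorem derivₗ_taylorComp {φ : 𝔻 → 𝔻} {ν μ : Weight} (hφ : IsHolomorphic fun z => (φ z : ℂ))
    (h : MapsBloch φ ν μ) (r : ℝ) (N : ℕ) (f : BlochSpace ν) (z : 𝔻) :
    BlochSpace.derivₗ μ z (taylorComp h r N f) =
      (∑ n ∈ Finset.range N, (r : ℂ) ^ (n + 1) * BlochSpace.coeff ν n f * (φ z : ℂ) ^ n) *
        discDeriv (fun z => (φ z : ℂ)) z := by
  have h1 : BlochSpace.derivₗ μ z (BlochSpace.ofMem (monomial_mem μ 0)) = 0 := by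
    change discDeriv (monomial 0) z = 0
    simp [discDeriv_monomial]
  have h2 : ∀ n : ℕ, BlochSpace.derivₗ μ z
      (compOp h (BlochSpace.ofMem (monomial_mem ν (n + 1)))) =
        ((n : ℂ) + 1) * (φ z : ℂ) ^ n * discDeriv (fun z => (φ z : ℂ)) z := fun n => by
    rw [derivₗ_compOp hφ, BlochSpace.incl_ofMem, discDeriv_monomial]
    simp
  simp only [taylorComp, add_apply, sum_apply,
    ContinuousLinearMap.smulRight_apply, map_add, map_sum, map_smul, map_sub, h1, h2, smul_eq_mul,
    mul_zero, sub_zero, zero_add, Finset.sum_mul]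
  refine Finset.sum_congr rfl fun n _ => ?_
  have hn : (n : ℂ) + 1 ≠ 0 := Nat.cast_add_one_ne_zero n
  field_simp

/-- The upper bound for the essential norm. -/
theorem Weight.IsLogType.exists_isCompactOperator_close {ν μ : Weight} {A : ℝ}
    (hν : ν.IsLogType A) {φ : 𝔻 → 𝔻} (hφ : IsHolomorphic fun z => (φ z : ℂ))
    (h : MapsBloch φ ν μ) {L ε : ℝ} (hL : 0 ≤ L) (hε : 0 < ε)
    (hlim : ∀ᶠ j in atTop, logRatio φ μ j ≤ ENNReal.ofReal L) :
    ∃ S : BlochSpace ν →L[ℂ] BlochSpace μ, IsCompactOperator S ∧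
      ‖(⟨compOp h, continuous_compOp h⟩ : BlochSpace ν →L[ℂ] BlochSpace μ) - S‖ ≤
        18 * A * L + ε := by
  obtain ⟨J, hJ⟩ := eventually_atTop.1 hlim
  have hA := hν.pos
  obtain ⟨M, hM⟩ := ν.bounded'
  have hM0 : 0 ≤ M := (ν.pos' 0).le.trans (hM 0)
  -- `φ` is the image of the identity function, so `P` bounds `μ |φ'|`.
  set P := ‖compOp h (BlochSpace.ofMem (monomial_mem ν 1))‖ with hPdef
  have hP0 : 0 ≤ P := norm_nonneg _
  have hP : ∀ z, μ z * ‖discDeriv (fun z => (φ z : ℂ)) z‖ ≤ P := fun z => by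
    have h1 := (compOp h (BlochSpace.ofMem (monomial_mem ν 1))).mul_norm_discDeriv_le z
    rw [incl_compOp, BlochSpace.incl_ofMem, ← selfMapPow_eq, norm_discDeriv_selfMapPow hφ] at h1
    simpa using h1
  set ρ := 1 - 1 / ((J : ℝ) + 1) with hρdef
  have hJ1 : (0 : ℝ) < (J : ℝ) + 1 := by positivity
  have hρ0 : 0 ≤ ρ := by
    have : 1 / ((J : ℝ) + 1) ≤ 1 := by
      rw [div_le_one hJ1]; linarith [Nat.cast_nonneg (α := ℝ) J]
    linarith
  have hρ1 : ρ < 1 := by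
    have : 0 < 1 / ((J : ℝ) + 1) := by positivity
    linarith
  obtain ⟨r, hr0, hr1, hr⟩ := BlochSpace.exists_dilate_close ν hρ0 hρ1
    (by positivity : 0 < ε / (2 * (P + 1)))
  obtain ⟨N, hN⟩ := BlochSpace.exists_taylor_close ν hr0 hr1
    -- The first tolerance serves where `|φ z| ≤ ρ`; the second makes `ν |gr - p| ≤ ‖f‖` everywhere,
    -- as `ν ≤ M`.
    (lt_min (by positivity : 0 < ε / (2 * (P + 1))) (by positivity : 0 < 1 / (M + 1)))
  refine ⟨taylorComp h r N, isCompactOperator_taylorComp h r N,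
    ContinuousLinearMap.opNorm_le_bound _ (by positivity) fun f => ?_⟩
  have hmain := (compOp h f - taylorComp h r N f).norm_le_add (a := 0)
    (b := (18 * A * L + ε) * ‖f‖) ?_ ?_
  · rw [zero_add] at hmain
    exact hmain
  · rw [map_sub, Pi.sub_apply, incl_taylorComp_zero]
    simp
  intro z
  change μ z * ‖BlochSpace.derivₗ μ z (compOp h f - taylorComp h r N f)‖ ≤ _
  rw [map_sub, derivₗ_compOp hφ, derivₗ_taylorComp hφ, ← sub_mul, norm_mul]
  set p := ∑ n ∈ Finset.range N, (r : ℂ) ^ (n + 1) * BlochSpace.coeff ν n f * (φ z : ℂ) ^ n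
  set D := ‖discDeriv (fun z => (φ z : ℂ)) z‖
  set g := discDeriv (BlochSpace.incl ν f) (φ z)
  set gr := (r : ℂ) * discDeriv (BlochSpace.incl ν f) (dilate hr0 hr1 (φ z)) with hgr
  have hμD : 0 ≤ μ z * D := mul_nonneg (μ.pos' z).le (norm_nonneg _)
  have hp := hN f (φ z)
  have hf := norm_nonneg f
  rw [show μ z * (‖g - p‖ * D) = μ z * D * ‖g - p‖ by ring]
  have htri : ‖g - p‖ ≤ ‖g - gr‖ + ‖gr - p‖ := by
    have := norm_add_le (g - gr) (gr - p)
    rwa [sub_add_sub_cancel] at this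
  rcases le_or_gt (J : ℝ) (1 / (1 - ‖(φ z : ℂ)‖)) with hz | hz
  · have h1 : μ z * D ≤ 6 * L * (A * ν (φ z)) :=
      (mul_norm_discDeriv_le_of_logRatio_le hφ hL (fun j _ hj => hJ j hj) z hz).trans
        (mul_le_mul_of_nonneg_left (hν.vlog_le _) (by positivity))
    have hνφ := (ν.pos' (φ z)).le
    -- Near the circle nothing is small: `g`, `gr` and `gr - p` each cost one `‖f‖`, whence `18 = 6
    -- * 3`. For `gr`, radial monotonicity of `ν` is what makes dilation harmless.
    have h2 : ν (φ z) * ‖g‖ ≤ ‖f‖ := f.mul_norm_discDeriv_le _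
    have h3 : ν (φ z) * ‖gr‖ ≤ ‖f‖ := by
      rw [hgr, norm_mul, Complex.norm_real, Real.norm_of_nonneg hr0.le]
      calc _ ≤ ν (dilate hr0 hr1 (φ z)) *
            (1 * ‖discDeriv (BlochSpace.incl ν f) (dilate hr0 hr1 (φ z))‖) := by
            gcongr
            exacts [(ν.pos' _).le, hν.antitone _ _ (norm_dilate_le hr0 hr1 _)]
        _ ≤ _ := by rw [one_mul]; exact f.mul_norm_discDeriv_le _
    have h4 : ν (φ z) * ‖gr - p‖ ≤ ‖f‖ := by
      calc _ ≤ M * (1 / (M + 1) * ‖f‖) := by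
            gcongr
            · exact hM _
            · exact hp.trans (by gcongr; exact min_le_right _ _)
        _ = M / (M + 1) * ‖f‖ := by ring
        _ ≤ 1 * ‖f‖ := by
            gcongr
            rw [div_le_one (by positivity)]
            linarith
        _ = ‖f‖ := one_mul _
    have h5 : ν (φ z) * ‖g - p‖ ≤ 3 * ‖f‖ := by
      have h6 : ‖g - p‖ ≤ ‖g‖ + ‖gr‖ + ‖gr - p‖ := htri.trans (by gcongr; exact norm_sub_le _ _)
      calc _ ≤ ν (φ z) * (‖g‖ + ‖gr‖ + ‖gr - p‖) := by gcongr
        _ ≤ _ := by rw [mul_add, mul_add]; linarith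
    calc μ z * D * ‖g - p‖ ≤ 6 * L * (A * ν (φ z)) * ‖g - p‖ := by gcongr
      _ = 6 * L * A * (ν (φ z) * ‖g - p‖) := by ring
      _ ≤ 6 * L * A * (3 * ‖f‖) := by gcongr
      _ = 18 * A * L * ‖f‖ := by ring
      _ ≤ _ := by gcongr; linarith
  · have hs : 0 < 1 - ‖(φ z : ℂ)‖ := sub_pos.2 (φ z).norm_lt_one
    have hzρ : ‖(φ z : ℂ)‖ ≤ ρ := by
      rw [div_lt_iff₀ hs] at hz
      have : 1 / ((J : ℝ) + 1) ≤ 1 - ‖(φ z : ℂ)‖ := by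
        rw [div_le_iff₀ hJ1]; nlinarith
      linarith
    have h1 := hr f (φ z) hzρ
    have h2 : ‖gr - p‖ ≤ ε / (2 * (P + 1)) * ‖f‖ :=
      hp.trans (by gcongr; exact min_le_left _ _)
    calc μ z * D * ‖g - p‖
        ≤ (P + 1) * (ε / (2 * (P + 1)) * ‖f‖ + ε / (2 * (P + 1)) * ‖f‖) := by
          refine mul_le_mul ((hP z).trans (by linarith)) (htri.trans (add_le_add h1 h2))
            (norm_nonneg _) (by positivity)
      _ = ε * ‖f‖ := by field_simp; ring
      _ ≤ _ := by
          gcongr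
          have : 0 ≤ 18 * A * L := by positivity
          linarith

/-! ### Boundedness, compactness and the essential norm in terms of `logRatio` -/

/-- The limit bounds only a tail; finiteness of the remaining terms is a separate hypothesis, since
values lie in `[0, ∞]`. -/
theorem supPos_lt_top_of_tendsto_zero {a : ℕ → ℝ≥0∞} (h : ∀ j, 1 ≤ j → a j < ∞)
    (ht : Tendsto a atTop (𝓝 0)) : supPos a < ∞ := by
  obtain ⟨J, hJ⟩ := eventually_atTop.1 (ht.eventually_le_const one_pos)
  have hfin : 1 + ∑ j ∈ (Finset.range J).filter (1 ≤ ·), a j < ∞ :=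
    ENNReal.add_lt_top.2 ⟨ENNReal.one_lt_top,
      ENNReal.sum_lt_top.2 fun j hj => h j (Finset.mem_filter.1 hj).2⟩
  refine lt_of_le_of_lt (iSup₂_le fun j hj => ?_) hfin
  rcases le_or_gt J j with hc | hc
  · exact (hJ j hc).trans le_self_add
  · exact (Finset.single_le_sum (f := a) (fun _ _ => zero_le)
      (Finset.mem_filter.2 ⟨Finset.mem_range.2 hc, hj⟩)).trans le_add_self

theorem lt_top_of_supPos_lt_top {a : ℕ → ℝ≥0∞} (h : supPos a < ∞) {j : ℕ} (hj : 1 ≤ j) :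
    a j < ∞ :=
  (le_iSup₂ (f := fun (j : ℕ) (_ : 1 ≤ j) => a j) j hj).trans_lt h

theorem limsup_le_supPos (a : ℕ → ℝ≥0∞) : limsup a atTop ≤ supPos a := by
  refine limsup_le_of_le (h := ?_)
  filter_upwards [eventually_ge_atTop 1] with j hj
  exact le_iSup₂ (f := fun (j : ℕ) (_ : 1 ≤ j) => a j) j hj

namespace Weight.IsLogType

variable {ν μ : Weight} {A : ℝ} {φ : 𝔻 → 𝔻}

theorem isBoundedComp_iff (hν : ν.IsLogType A) (hφ : IsHolomorphic fun z => (φ z : ℂ)) :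
    IsBoundedComp φ ν μ ↔ supPos (logRatio φ μ) < ∞ :=
  isBoundedComp_iff_mapsBloch.trans
    ⟨hν.supPos_logRatio_lt_top, hν.mapsBloch_of_supPos_lt_top hφ⟩

theorem isCompactComp_iff (hν : ν.IsLogType A) (hφ : IsHolomorphic fun z => (φ z : ℂ)) :
    IsCompactComp φ ν μ ↔
      (∀ j : ℕ, 1 ≤ j → logRatio φ μ j < ∞) ∧ Tendsto (logRatio φ μ) atTop (𝓝 0) := by
  constructor
  · rintro ⟨h, hc⟩
    refine ⟨fun j hj => lt_top_of_supPos_lt_top (hν.supPos_logRatio_lt_top h) hj, ?_⟩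
    -- The lower bound is applied with `S` equal to `C_φ` itself.
    have h1 := hν.limsup_logRatio_le h
      (S := ⟨compOp h, continuous_compOp h⟩) hc
    rw [sub_self, norm_zero, zero_mul, ENNReal.ofReal_zero] at h1
    exact tendsto_of_le_liminf_of_limsup_le zero_le h1
  · rintro ⟨hfin, ht⟩
    have h := hν.mapsBloch_of_supPos_lt_top hφ (supPos_lt_top_of_tendsto_zero hfin ht)
    refine ⟨h, ?_⟩
    have hcl := isClosed_setOfPred_isCompactOperator (σ₁₂ := RingHom.id ℂ)
      (M₁ := BlochSpace ν) (M₂ := BlochSpace μ)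
    refine hcl.closure_subset (a := (⟨compOp h, continuous_compOp h⟩ :
      BlochSpace ν →L[ℂ] BlochSpace μ)) (Metric.mem_closure_iff.2 fun ε hε => ?_)
    have hA := hν.pos
    -- The value of `L` makes `18 A L = ε / 3`, so the distance to `S` is at most `2ε / 3`.
    obtain ⟨S, hS, hle⟩ := hν.exists_isCompactOperator_close hφ h
      (L := ε / (3 * (18 * A))) (ε := ε / 3) (by positivity) (by positivity)
      (ht.eventually_le_const (by simpa using (by positivity : 0 < ε / (3 * (18 * A)))))
    refine ⟨S, hS, ?_⟩
    rw [dist_eq_norm]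
    have h2 : 18 * A * (ε / (3 * (18 * A))) = ε / 3 := by field_simp
    linarith

theorem limsup_logRatio_le_essNorm (hν : ν.IsLogType A) (h : MapsBloch φ ν μ) :
    limsup (logRatio φ μ) atTop ≤
      ENNReal.ofReal (3 * A) * ENNReal.ofReal (essNorm (⟨compOp h, continuous_compOp h⟩ :
        BlochSpace ν →L[ℂ] BlochSpace μ)) := by
  have hA : 0 < 3 * A := by linarith [hν.pos]
  have hfin := ((limsup_le_supPos _).trans_lt (hν.supPos_logRatio_lt_top h)).ne
  rw [← ENNReal.ofReal_mul hA.le, ← ENNReal.ofReal_toReal hfin]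
  refine ENNReal.ofReal_le_ofReal ?_
  rw [← div_le_iff₀' hA]
  refine le_csInf ⟨_, 0, isCompactOperator_zero, rfl⟩ ?_
  rintro _ ⟨S, hS, rfl⟩
  rw [div_le_iff₀ hA]
  exact ENNReal.toReal_le_of_le_ofReal (by positivity) (hν.limsup_logRatio_le h hS)

theorem essNorm_le_limsup_logRatio (hν : ν.IsLogType A) (hφ : IsHolomorphic fun z => (φ z : ℂ))
    (h : MapsBloch φ ν μ) :
    ENNReal.ofReal (essNorm (⟨compOp h, continuous_compOp h⟩ :
      BlochSpace ν →L[ℂ] BlochSpace μ)) ≤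
        ENNReal.ofReal (18 * A) * limsup (logRatio φ μ) atTop := by
  have hA := hν.pos
  have hfin := ((limsup_le_supPos _).trans_lt (hν.supPos_logRatio_lt_top h)).ne
  set E := (limsup (logRatio φ μ) atTop).toReal with hE
  rw [← ENNReal.ofReal_toReal hfin, ← ENNReal.ofReal_mul (by positivity), ← hE]
  refine ENNReal.ofReal_le_ofReal (le_of_forall_pos_le_add fun ε hε => ?_)
  have hE0 : 0 ≤ E := ENNReal.toReal_nonneg
  -- A limit superior bounds the tail only by numbers strictly above it, so `E` is enlarged by an
  -- amount costing `ε / 2`.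
  have hlt : limsup (logRatio φ μ) atTop < ENNReal.ofReal (E + ε / (2 * (18 * A))) := by
    rw [← ENNReal.ofReal_toReal hfin, ← hE, ENNReal.ofReal_lt_ofReal_iff (by positivity)]
    have : 0 < ε / (2 * (18 * A)) := by positivity
    linarith
  obtain ⟨S, hS, hle⟩ := hν.exists_isCompactOperator_close hφ h
    (L := E + ε / (2 * (18 * A))) (ε := ε / 2) (by positivity) (by positivity)
    ((eventually_lt_of_limsup_lt hlt).mono fun _ hj => hj.le)
  refine le_trans (csInf_le ?_ ?_) (hle.trans_eq ?_)
  · refine ⟨0, ?_⟩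
    rintro _ ⟨S, -, rfl⟩
    exact norm_nonneg _
  · exact ⟨S, hS, rfl⟩
  · field_simp
    ring

end Weight.IsLogType

end LogBloch

end

/-! ### Transfer from `logRatio` to `normRatio`, and the constant `K` -/

theorem theorem7p1 (k : ℕ) (hk : k = 1 ∨ k = 2) (θ : ℝ) (hθ : Real.exp 1 ≤ θ) :
    -- (A) boundedness and (B) compactness
    (∀ (φ : 𝔻 → 𝔻) (μ : LogBloch.Weight), LogBloch.IsHolomorphic (fun z => (φ z : ℂ)) →
      ((LogBloch.IsBoundedComp φ
            (LogBloch.logWeight k θ hk (LogBloch.one_lt_of_exp_le hθ)) μ ↔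
          LogBloch.supPos (LogBloch.normRatio φ μ) < ∞) ∧
        (LogBloch.IsBoundedComp φ
            (LogBloch.logWeight k θ hk (LogBloch.one_lt_of_exp_le hθ)) μ ↔
          LogBloch.supPos (LogBloch.logRatio φ μ) < ∞)) ∧
      ((LogBloch.IsCompactComp φ
            (LogBloch.logWeight k θ hk (LogBloch.one_lt_of_exp_le hθ)) μ ↔
          (∀ j : ℕ, 1 ≤ j → LogBloch.normRatio φ μ j < ∞) ∧
            Tendsto (LogBloch.normRatio φ μ) atTop (𝓝 0)) ∧
        (LogBloch.IsCompactComp φ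
            (LogBloch.logWeight k θ hk (LogBloch.one_lt_of_exp_le hθ)) μ ↔
          (∀ j : ℕ, 1 ≤ j → LogBloch.logRatio φ μ j < ∞) ∧
            Tendsto (LogBloch.logRatio φ μ) atTop (𝓝 0)))) ∧
    -- (C) the essential norm, with a constant that depends on `k` and `θ` only
    (∃ K : ℝ≥0, 0 < K ∧
      ∀ (φ : 𝔻 → 𝔻) (μ : LogBloch.Weight), LogBloch.IsHolomorphic (fun z => (φ z : ℂ)) →
        ∀ h : LogBloch.MapsBloch φ
            (LogBloch.logWeight k θ hk (LogBloch.one_lt_of_exp_le hθ)) μ,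
          ∃ hc : Continuous (LogBloch.compOp h),
            LogBloch.EquivUpTo K
              (ENNReal.ofReal (LogBloch.essNorm ⟨LogBloch.compOp h, hc⟩))
              (limsup (LogBloch.normRatio φ μ) atTop) ∧
            LogBloch.EquivUpTo K
              (limsup (LogBloch.normRatio φ μ) atTop)
              (limsup (LogBloch.logRatio φ μ) atTop)) := by
  have hν := LogBloch.logWeight_isLogType hk hθ
  set A := 2 * (Real.log θ + 1)
  refine ⟨fun φ μ hφ => ⟨⟨?_, hν.isBoundedComp_iff hφ⟩, ?_, hν.isCompactComp_iff hφ⟩, ?_⟩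
  · rw [hν.isBoundedComp_iff hφ]
    exact ⟨LogBloch.supPos_lt_top_of_le fun _ => LogBloch.normRatio_le_logRatio φ μ,
      LogBloch.supPos_lt_top_of_le fun _ => LogBloch.logRatio_le_normRatio φ μ⟩
  · rw [hν.isCompactComp_iff hφ]
    refine and_congr (forall₂_congr fun j hj => ⟨fun h => ?_, fun h => ?_⟩)
      ⟨LogBloch.tendsto_zero_of_le fun _ => LogBloch.normRatio_le_logRatio φ μ,
        LogBloch.tendsto_zero_of_le fun _ => LogBloch.logRatio_le_normRatio φ μ⟩
    · exact (LogBloch.normRatio_le_logRatio φ μ hj).trans_lt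
        (ENNReal.mul_lt_top ENNReal.coe_lt_top h)
    · exact (LogBloch.logRatio_le_normRatio φ μ hj).trans_lt
        (ENNReal.mul_lt_top ENNReal.coe_lt_top h)
  · have hA := hν.pos
    have hK : ((54 * A + 3).toNNReal : ℝ≥0∞) = ENNReal.ofReal (54 * A + 3) := rfl
    have hK3 : ((3 : ℝ≥0) : ℝ≥0∞) ≤ ENNReal.ofReal (54 * A + 3) := by
      rw [show ((3 : ℝ≥0) : ℝ≥0∞) = ENNReal.ofReal 3 by norm_num]
      exact ENNReal.ofReal_le_ofReal (by linarith)
    have h3 : ∀ a : ℝ, 0 ≤ a → a ≤ 18 * A →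
        ((3 : ℝ≥0) : ℝ≥0∞) * ENNReal.ofReal a ≤ ENNReal.ofReal (54 * A + 3) := fun a ha ha' => by
      rw [show ((3 : ℝ≥0) : ℝ≥0∞) = ENNReal.ofReal 3 by norm_num,
        ← ENNReal.ofReal_mul (by norm_num)]
      exact ENNReal.ofReal_le_ofReal (by linarith)
    -- `54 A` is the factor 3 between the quotients times `18 A` (the lower bound needs only `9 A`);
    -- the summand 3 covers the comparison of the two limits superior.
    refine ⟨(54 * A + 3).toNNReal, Real.toNNReal_pos.2 (by positivity), fun φ μ hφ h =>
      ⟨LogBloch.continuous_compOp h, ?_, ?_⟩⟩ <;> unfold LogBloch.EquivUpTo <;> rw [hK]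
    all_goals
      have h12 := LogBloch.limsup_le_of_le_mul fun _ => LogBloch.normRatio_le_logRatio φ μ
      have h21 := LogBloch.limsup_le_of_le_mul fun _ => LogBloch.logRatio_le_normRatio φ μ
    · constructor
      · refine (hν.essNorm_le_limsup_logRatio hφ h).trans
          ((mul_le_mul_right h21 _).trans ?_)
        rw [← mul_assoc, mul_comm (ENNReal.ofReal _)]
        exact mul_le_mul_left (h3 _ (by positivity) le_rfl) _
      · refine h12.trans ((mul_le_mul_right (hν.limsup_logRatio_le_essNorm h) _).trans ?_)
        rw [← mul_assoc]
        exact mul_le_mul_left (h3 _ (by positivity) (by linarith)) _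
    · exact ⟨h12.trans (mul_le_mul_left hK3 _), h21.trans (mul_le_mul_left hK3 _)⟩
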